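/- Let $n\ge 1$. A \emph{smooth graph hypersurface} in $\mathbb R^n$ is a set $\{x+\varphi(x)v : x\in D\}$, where $v$ is a unit vector, $D$ is a bounded open subset of $v^\perp$ and $\varphi:D\to\mathbb R$ is $C^\infty$. It is a \emph{smooth graph hypersurface with piecewise smooth boundary} if instead it is of the form $\{x+\varphi(x)v : x\in \overline D\}$, where $D$ is a bounded open subset of $v^\perp$ with piecewise smooth boundary (that is, $\partial D$ is covered by finitely many smooth graph hypersurfaces of $v^\perp$) and $\varphi$ is $C^\infty$ on a neighbourhood of $\overline D$. A subset $\Sigma\subset\mathbb R^n$ is a \emph{smooth hypersurface} if it is a finite union of smooth graph hypersurfaces of finite area and of smooth graph hypersurfaces with piecewise smooth boundary. Its area measure $\omega_\Sigma$ is the $(n-1)$-dimensional Hausdorff measure on $\Sigma$ (normalized to agree with Lebesgue measure on $\mathbb R^{n-1}$). Let $\mathbf L^n$ be the space of oriented lines in $\mathbb R^n$, identified with the pairs $(v,p)$ with $v\in S^{n-1}$ and $p\in v^\perp$, where $(v,p)$ is the line $\{tv+p : t\in\mathbb R\}$. The kinematic measure $\mu$ on $\mathbf L^n$ is given by $\int_{\mathbf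 L^n} g\,d\mu=\int_{S^{n-1}}\left(\int_{v^\perp} g(v,p)\,dp\right)d\sigma(v)$, where $dp$ is Lebesgue measure on $v^\perp$ and $\sigma$ is the area measure of the unit sphere. A line $\ell=(v,p)$ is transverse to $\Sigma$ if at every point $x\in\ell\cap\Sigma$ the vector $v$ and the tangent space of $\Sigma$ at $x$ (the linear span of the vectors tangent to $\Sigma$ at $x$) together span $\mathbb R^n$. For $f:\Sigma\to\mathbb R$ put $f^\Sigma(\ell)=\sum_{x\in\ell\cap\Sigma}f(x)$ if $\ell$ is transverse to $\Sigma$, and $f^\Sigma(\ell)=0$ otherwise (the sum is read as $0$ if it has infinitely many non-zero terms, which happens only for a $\mu$-null set of lines). Let $\kappa_m$ be the volume of the unit ball of $\mathbb R^m$. \textbf{The Cauchy–Crofton Principle.} If $\Sigma$ is a compact smooth hypersurface in $\mathbb R^n$ and $f:\Sigma\to\mathbb R$ is continuous, then $f$ is $\omega_\Sigma$-integrable, $f^\Sigma$ is $\mu$-integrable, and $$\int_\Sigma f\,d\omega_\Sigma=\frac1{2\kappa_{n-1}}\int_{\mathbf L^n} f^\Sigma(\ell)\,d\mu(\ell).$$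 -/

import Mathlib

open MeasureTheory Set
open scoped ContDiff InnerProductSpace

noncomputable section

namespace CauchyCrofton

section Hypersurfaces

variable {E : Type*} [NormedAddCommGroup E] [InnerProductSpace ℝ E]

/-- The graph `{x + φ(x) v : x ∈ A}` in direction `v` of a function on a subset `A` of `v^⊥`. -/
def graphOver (v : E) (φ : (ℝ ∙ v)ᗮ → ℝ) (A : Set (ℝ ∙ v)ᗮ) : Set E :=
  (fun x : (ℝ ∙ v)ᗮ => (x : E) + φ x • v) '' A

/-- A smooth graph hypersurface: the graph, in a unit direction `v`, of a smooth function on a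
bounded open subset of `v^⊥`. -/
def IsSmoothGraph (S : Set E) : Prop :=
  ∃ (v : E) (D : Set (ℝ ∙ v)ᗮ) (φ : (ℝ ∙ v)ᗮ → ℝ),
    ‖v‖ = 1 ∧ IsOpen D ∧ Bornology.IsBounded D ∧ ContDiffOn ℝ ∞ φ D ∧ S = graphOver v φ D

/-- The boundary of `D` is piecewise smooth: it is covered by finitely many smooth graph
hypersurfaces of the ambient space of `D`. -/
def HasPiecewiseSmoothBoundary (D : Set E) : Prop :=
  ∃ T : Set (Set E), T.Finite ∧ (∀ S ∈ T, IsSmoothGraph S) ∧ frontier D ⊆ ⋃₀ T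

/-- A smooth graph hypersurface with piecewise smooth boundary: the graph over the closure of a
bounded open `D ⊆ v^⊥` with piecewise smooth boundary of a function that is smooth up to and
across the boundary of `D`. -/
def IsSmoothGraphWithBoundary (S : Set E) : Prop :=
  ∃ (v : E) (D U : Set (ℝ ∙ v)ᗮ) (φ : (ℝ ∙ v)ᗮ → ℝ),
    ‖v‖ = 1 ∧ IsOpen D ∧ Bornology.IsBounded D ∧ HasPiecewiseSmoothBoundary D ∧
      IsOpen U ∧ closure D ⊆ U ∧ ContDiffOn ℝ ∞ φ U ∧ S = graphOver v φ (closure D)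

end Hypersurfaces

/-- A smooth hypersurface of `ℝⁿ`: a finite union of smooth graph hypersurfaces, each of them
either without boundary (and then of finite area) or with piecewise smooth boundary. -/
def IsSmoothHypersurface {n : ℕ} (M : Set (EuclideanSpace ℝ (Fin n))) : Prop :=
  ∃ T : Set (Set (EuclideanSpace ℝ (Fin n))), T.Finite ∧
    (∀ S ∈ T, (IsSmoothGraph S ∧ μHE[n - 1] S < ⊤) ∨ IsSmoothGraphWithBoundary S) ∧ M = ⋃₀ T

/-- The area measure of a hypersurface, a measure on the points of the hypersurface: the
restriction of the normalized `(n-1)`-dimensional Hausdorff measure of `ℝⁿ`. -/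
def areaMeasure {n : ℕ} (M : Set (EuclideanSpace ℝ (Fin n))) : Measure M :=
  (μHE[n - 1] : Measure (EuclideanSpace ℝ (Fin n))).comap Subtype.val

/-- Oriented lines in `ℝⁿ`, as pairs `(v, p)` of a unit direction `v` and a foot point `p ∈ v^⊥`. -/
abbrev OrientedLine (n : ℕ) : Type :=
  {q : EuclideanSpace ℝ (Fin n) × EuclideanSpace ℝ (Fin n) // ‖q.1‖ = 1 ∧ ⟪q.1, q.2⟫_ℝ = 0}

namespace OrientedLine

variable {n : ℕ}

/-- The unit direction vector of an oriented line. -/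
def dir (l : OrientedLine n) : EuclideanSpace ℝ (Fin n) := l.1.1

/-- The point of an oriented line that is nearest to the origin. -/
def foot (l : OrientedLine n) : EuclideanSpace ℝ (Fin n) := l.1.2

/-- The set of points `t v + p` of the line. -/
def points (l : OrientedLine n) : Set (EuclideanSpace ℝ (Fin n)) :=
  range fun t : ℝ => t • l.dir + l.foot

/-- The oriented line `(v, p)`, for `v` in the unit sphere and `p` in `v^⊥`. -/
def mk (v : Metric.sphere (0 : EuclideanSpace ℝ (Fin n)) 1)
    (p : (ℝ ∙ (v : EuclideanSpace ℝ (Fin n)))ᗮ) : OrientedLine n :=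
  ⟨((v : EuclideanSpace ℝ (Fin n)), (p : EuclideanSpace ℝ (Fin n))),
    norm_eq_of_mem_sphere v, Submodule.mem_orthogonal_singleton_iff_inner_right.1 p.2⟩

/-- The line is transverse to `M`: at each point of intersection its direction and the tangent
space of `M` (the linear span of the vectors tangent to `M` at this point) span `ℝⁿ`. -/
def IsTransverse (l : OrientedLine n) (M : Set (EuclideanSpace ℝ (Fin n))) : Prop :=
  ∀ x ∈ l.points ∩ M, (ℝ ∙ l.dir) ⊔ Submodule.span ℝ (tangentConeAt ℝ M x) = ⊤

end OrientedLine

/-- Lebesgue measure on the lines of direction `v`, that is on `{v} × v^⊥`. -/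
def parallelMeasure {n : ℕ} (v : Metric.sphere (0 : EuclideanSpace ℝ (Fin n)) 1) :
    Measure (OrientedLine n) :=
  (volume : Measure (ℝ ∙ (v : EuclideanSpace ℝ (Fin n)))ᗮ).map (OrientedLine.mk v)

/-- The kinematic measure on oriented lines: `∫ g dμ = ∫_{S^{n-1}} (∫_{v^⊥} g(v, p) dp) dσ(v)`,
where `σ` is the area measure of the unit sphere. -/
def kinematicMeasure (n : ℕ) : Measure (OrientedLine n) :=
  ((volume : Measure (EuclideanSpace ℝ (Fin n))).toSphere).bind parallelMeasure

theorem measurable_mk {n : ℕ} (v : Metric.sphere (0 : EuclideanSpace ℝ (Fin n)) 1) :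
    Measurable (OrientedLine.mk v) :=
  (measurable_const.prodMk measurable_subtype_coe).subtype_mk

/-- The measures `parallelMeasure v` depend measurably on `v`, as `Measure.bind` needs. -/
theorem measurable_parallelMeasure {n : ℕ} :
    Measurable (parallelMeasure : Metric.sphere (0 : EuclideanSpace ℝ (Fin n)) 1 → _) := by
  refine Measure.measurable_of_measurable_coe _ fun A hA => ?_
  let P : Metric.sphere (0 : EuclideanSpace ℝ (Fin n)) 1 × EuclideanSpace ℝ (Fin n) →
      OrientedLine n := fun q =>
    OrientedLine.mk q.1 ((ℝ ∙ (q.1 : EuclideanSpace ℝ (Fin n)))ᗮ.orthogonalProjectionOnto q.2)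
  have key : ∀ q, ((P q).1.2 : EuclideanSpace ℝ (Fin n)) =
      q.2 - ⟪(q.1 : EuclideanSpace ℝ (Fin n)), q.2⟫_ℝ • (q.1 : EuclideanSpace ℝ (Fin n)) := by
    rintro ⟨v, x⟩
    have hv : ‖(v : EuclideanSpace ℝ (Fin n))‖ = 1 := norm_eq_of_mem_sphere v
    have h1 := Submodule.starProjection_unit_singleton ℝ hv x
    have h2 := Submodule.starProjection_orthogonal_val
      (K := ℝ ∙ (v : EuclideanSpace ℝ (Fin n))) x
    rw [h1] at h2
    exact h2
  have hP : Measurable P := by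
    have h2 : Measurable fun q => (P q).1.2 := by
      simp_rw [key]
      fun_prop
    exact ((measurable_subtype_coe.comp measurable_fst).prodMk h2).subtype_mk
  let c : ENNReal := ENNReal.ofReal (√Real.pi ^ 1 / Real.Gamma (1 / 2 + 1))
  have hc0 : c ≠ 0 := by
    have : 0 < Real.Gamma (1 / 2 + 1) := Real.Gamma_pos_of_pos (by norm_num)
    simp only [c, ne_eq, ENNReal.ofReal_eq_zero, not_le]
    positivity
  have hvol : ∀ v : Metric.sphere (0 : EuclideanSpace ℝ (Fin n)) 1,
      parallelMeasure v A = c⁻¹ * volume (Prod.mk v ⁻¹'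
        (P ⁻¹' A ∩ {q | |⟪(q.1 : EuclideanSpace ℝ (Fin n)), q.2⟫_ℝ| < 1})) := by
    intro v
    have hv : ‖(v : EuclideanSpace ℝ (Fin n))‖ = 1 := norm_eq_of_mem_sphere v
    set K := (ℝ ∙ (v : EuclideanSpace ℝ (Fin n))) with hK
    have hfin : Module.finrank ℝ K = 1 := finrank_span_singleton (norm_ne_zero_iff.1 (by simp [hv]))
    have : Nontrivial K := Module.nontrivial_of_finrank_pos (R := ℝ) (by omega)
    have hball : volume (Metric.ball (0 : K) 1) = c := by
      rw [InnerProductSpace.volume_ball, hfin]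
      simp [c]
    have hmp := K.measurePreserving_measurableEquivProd (0 : EuclideanSpace ℝ (Fin n))
    rw [InnerProductSpace.euclideanHausdorffMeasure_eq_volume] at hmp
    have hset : Prod.mk v ⁻¹' (P ⁻¹' A ∩
        {q | |⟪(q.1 : EuclideanSpace ℝ (Fin n)), q.2⟫_ℝ| < 1}) =
        K.measurableEquivProd (0 : EuclideanSpace ℝ (Fin n)) ⁻¹'
          (Metric.ball (0 : K) 1 ×ˢ (OrientedLine.mk v ⁻¹' A)) := by
      ext x
      have h1 : (K.orthogonalProjectionOnto x : EuclideanSpace ℝ (Fin n)) =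
          ⟪(v : EuclideanSpace ℝ (Fin n)), x⟫_ℝ • (v : EuclideanSpace ℝ (Fin n)) :=
        Submodule.starProjection_unit_singleton ℝ hv x
      have h2 : ‖K.orthogonalProjectionOnto x‖ = |⟪(v : EuclideanSpace ℝ (Fin n)), x⟫_ℝ| := by
        rw [← Submodule.norm_coe, h1, norm_smul, hv, mul_one, Real.norm_eq_abs]
      simp [P, h2, and_comm, K]
    rw [hset, hmp.measure_preimage_equiv, Measure.volume_eq_prod, Measure.prod_prod, hball,
      ← mul_assoc, ENNReal.inv_mul_cancel hc0 ENNReal.ofReal_ne_top, one_mul, parallelMeasure,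
      Measure.map_apply (measurable_mk v) hA]
  simp_rw [hvol]
  refine (measurable_measure_prodMk_left ((hP hA).inter ?_)).const_mul _
  refine measurableSet_lt ?_ measurable_const
  fun_prop

/-- The kinematic measure is the iterated integral over directions and foot points. -/
theorem lintegral_kinematicMeasure {n : ℕ} {g : OrientedLine n → ENNReal} (hg : Measurable g) :
    ∫⁻ l, g l ∂(kinematicMeasure n) =
      ∫⁻ v, (∫⁻ p, g (OrientedLine.mk v p))
        ∂(volume : Measure (EuclideanSpace ℝ (Fin n))).toSphere := by
  rw [kinematicMeasure, Measure.lintegral_bind measurable_parallelMeasure.aemeasurable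
    hg.aemeasurable]
  exact lintegral_congr fun v => lintegral_map hg (measurable_mk v)

open Classical in
/-- The sum of `f` over the intersection points of `l` and `M` if `l` is transverse to `M`,
and `0` otherwise. -/
def lineSum {n : ℕ} {M : Set (EuclideanSpace ℝ (Fin n))} (f : M → ℝ) (l : OrientedLine n) : ℝ :=
  if l.IsTransverse M then ∑ᶠ x ∈ {x : M | (x : EuclideanSpace ℝ (Fin n)) ∈ l.points}, f x else 0

/-- The volume of the unit ball of `ℝᵐ`. -/
def ballVolume (m : ℕ) : ℝ :=
  volume.real (Metric.ball (0 : EuclideanSpace ℝ (Fin m)) 1)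

end CauchyCrofton

end

/-! Weighting each set by the average number of points in which lines meet it inside `M` defines a
measure, `crossingMeasure`. The theorem says that this measure is `2κ_{n-1}` times area on `M`: for
almost every line the sum of `f` is the integral of `f` against counting measure on the intersection
(`lineSum_eq_integral`), and integrating over lines gives the formula.

The two measures are compared on pieces `A` so small that they hardly deviate from a hyperplane
`w^⊥`. Unless `v` is almost tangent, projection along `v` is injective on `A` and scales its area by
about `|⟪v, w⟫|` (`exists_flat_bounds`), so this is what the lines of direction `v` count. The
integral of `|⟪v, w⟫|` over the sphere is `2κ_{n-1}` (`integral_abs_inner_toSphere`). Almost tangent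
directions fill a thin band of the sphere, where Eilenberg's inequality (`lintegral_count_fiber_le`)
bounds the count by the area of `A`. The error is thus `η` times the area of the piece; summed over
a countable partition it is `η` times a finite area, and `η → 0`.

The same band shows that almost every line is transverse: a line tangent to a flat piece has its
direction in the band. Boundaries of pieces have no area, so by Eilenberg's inequality almost no
line meets them. -/

noncomputable section

namespace CauchyCrofton

open Filter Topology
open scoped ENNReal NNReal

/-! ### Comparison of Hausdorff measures of two images of a set -/

section Hausdorff

/-- If `h` is Lipschitz relative to `g` on `A`, then the Hausdorff measure of `h '' A` is controlled
by that of `g '' A`. -/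
theorem euclideanHausdorffMeasure_image_le_of_dist_le {α X Y : Type*} [MetricSpace X]
    [MeasurableSpace X] [BorelSpace X] [MetricSpace Y] [MeasurableSpace Y] [BorelSpace Y] (m : ℕ)
    {A : Set α} {g : α → X} {h : α → Y} {K : ℝ≥0}
    (hK : ∀ x ∈ A, ∀ y ∈ A, dist (h x) (h y) ≤ K * dist (g x) (g y)) :
    μHE[m] (h '' A) ≤ (K : ℝ≥0∞) ^ m * μHE[m] (g '' A) := by
  rcases A.eq_empty_or_nonempty with rfl | ⟨a₀, ha₀⟩
  · simp
  have : Nonempty α := ⟨a₀⟩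
  let i : X → α := Function.invFunOn g A
  have hi : ∀ y ∈ g '' A, i y ∈ A ∧ g (i y) = y := fun y hy =>
    ⟨Function.invFunOn_mem hy, Function.invFunOn_eq hy⟩
  have hLip : LipschitzOnWith K (h ∘ i) (g '' A) := by
    refine LipschitzOnWith.of_dist_le_mul fun x hx y hy => ?_
    have := hK _ (hi x hx).1 _ (hi y hy).1
    rwa [(hi x hx).2, (hi y hy).2] at this
  -- The hypothesis forces `h` to agree wherever `g` does, so the choice of preimages made by `i` is
  -- immaterial.
  have himg : (h ∘ i) '' (g '' A) = h '' A := by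
    rw [image_image]
    refine image_congr fun x hx => ?_
    have h1 := hi (g x) (mem_image_of_mem g hx)
    have h2 := hK _ h1.1 x hx
    rw [h1.2, dist_self, mul_zero] at h2
    exact dist_le_zero.1 h2
  have := hLip.hausdorffMeasure_image_le (d := m) (by positivity)
  rw [himg, ENNReal.rpow_natCast] at this
  simp only [Measure.euclideanHausdorffMeasure_def, Measure.smul_apply, ENNReal.smul_def,
    smul_eq_mul]
  rw [mul_left_comm]
  gcongr

end Hausdorff

/-! ### Orthogonal projections of hyperplanes and of nearly flat sets -/

section Projection

variable {E : Type*} [NormedAddCommGroup E] [InnerProductSpace ℝ E]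

/-- Orthogonal projection along `v`, onto the hyperplane `v^⊥`. -/
abbrev perpProj (v : E) : E →L[ℝ] (ℝ ∙ v)ᗮ := (ℝ ∙ v)ᗮ.orthogonalProjectionOnto

theorem coe_perpProj {v : E} (hv : ‖v‖ = 1) (x : E) :
    (perpProj v x : E) = x - ⟪v, x⟫_ℝ • v := by
  have h1 := Submodule.starProjection_unit_singleton ℝ hv x
  have h2 := Submodule.starProjection_orthogonal_val (K := ℝ ∙ v) x
  rw [h1] at h2
  exact h2

theorem inner_perpProj {v : E} (hv : ‖v‖ = 1) (x y : E) :
    ⟪perpProj v x, perpProj v y⟫_ℝ = ⟪x, y⟫_ℝ - ⟪v, x⟫_ℝ * ⟪v, y⟫_ℝ := by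
  rw [Submodule.coe_inner, coe_perpProj hv, coe_perpProj hv]
  simp only [inner_sub_left, inner_sub_right, inner_smul_left, inner_smul_right,
    real_inner_self_eq_norm_sq, hv, real_inner_comm v x]
  simp

theorem norm_perpProj_sq {v : E} (hv : ‖v‖ = 1) (x : E) :
    ‖perpProj v x‖ ^ 2 = ‖x‖ ^ 2 - ⟪v, x⟫_ℝ ^ 2 := by
  rw [← real_inner_self_eq_norm_sq, inner_perpProj hv, real_inner_self_eq_norm_sq]
  ring

theorem norm_perpProj_le (v x : E) : ‖perpProj v x‖ ≤ ‖x‖ :=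
  Submodule.norm_orthogonalProjectionOnto_apply_le _ x

theorem inner_eq_zero_of_perp {w : E} (y : (ℝ ∙ w)ᗮ) : ⟪w, (y : E)⟫_ℝ = 0 :=
  Submodule.mem_orthogonal_singleton_iff_inner_right.1 y.2

/-- On the hyperplane `w^⊥`, projection along `v` shrinks norms at most by `|⟪v, w⟫|`. -/
theorem abs_inner_mul_norm_le_norm_perpProj {v w : E} (hv : ‖v‖ = 1) (hw : ‖w‖ = 1)
    (y : (ℝ ∙ w)ᗮ) : |⟪v, w⟫_ℝ| * ‖y‖ ≤ ‖perpProj v (y : E)‖ := by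
  have h1 : ⟪v, (y : E)⟫_ℝ = ⟪perpProj w v, y⟫_ℝ := by
    rw [Submodule.coe_inner, coe_perpProj hw, inner_sub_left, inner_smul_left,
      inner_eq_zero_of_perp]
    simp
  have h2 : ⟪v, (y : E)⟫_ℝ ^ 2 ≤ ‖perpProj w v‖ ^ 2 * ‖y‖ ^ 2 := by
    rw [h1, ← mul_pow, sq_le_sq, abs_of_nonneg (by positivity : 0 ≤ ‖perpProj w v‖ * ‖y‖)]
    exact abs_real_inner_le_norm _ _
  rw [norm_perpProj_sq hw, hv, real_inner_comm v w] at h2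
  have h3 := norm_perpProj_sq hv (y : E)
  refine le_of_sq_le_sq ?_ (norm_nonneg _)
  rw [mul_pow, sq_abs, h3, Submodule.norm_coe]
  linarith

/-- `A` deviates from the hyperplane `w^⊥` by at most the slope `ε`. -/
def IsFlat (w : E) (ε : ℝ) (A : Set E) : Prop :=
  ∀ x ∈ A, ∀ y ∈ A, |⟪w, x - y⟫_ℝ| ≤ ε * ‖x - y‖

theorem IsFlat.mono {w : E} {ε : ℝ} {A B : Set E} (h : IsFlat w ε B) (hAB : A ⊆ B) :
    IsFlat w ε A := fun x hx y hy => h x (hAB hx) y (hAB hy)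

theorem euclideanHausdorffMeasure_perpProj_image_le [MeasurableSpace E] [BorelSpace E] (m : ℕ) (v : E) (A : Set E) :
    μHE[m] (perpProj v '' A) ≤ μHE[m] A := by
  have := euclideanHausdorffMeasure_image_le_of_dist_le m (A := A) (g := id) (h := perpProj v)
    (K := 1) fun x _ y _ => by
      rw [dist_eq_norm, ← map_sub]
      simpa [dist_eq_norm] using norm_perpProj_le v (x - y)
  simpa using this

variable [FiniteDimensional ℝ E] {m : ℕ}

theorem finrank_perp (hm : Module.finrank ℝ E = m + 1) {v : E} (hv : ‖v‖ = 1) :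
    Module.finrank ℝ (ℝ ∙ v)ᗮ = m := by
  have h1 : Module.finrank ℝ (ℝ ∙ v) = 1 :=
    finrank_span_singleton (norm_ne_zero_iff.1 (by simp [hv]))
  have h2 := (ℝ ∙ v).finrank_add_finrank_orthogonal
  omega

/-- With `a` the component of `v` in `w^⊥`, the operator `T* T` is the rank-one perturbation `y ↦ y
- ⟪a, y⟫ a` of the identity, whose determinant is `1 - ‖a‖² = ⟪v, w⟫²`. -/
theorem normDet_perpProj_subtype {v w : E} (hv : ‖v‖ = 1) (hw : ‖w‖ = 1) :
    ((perpProj v).toLinearMap ∘ₗ (ℝ ∙ w)ᗮ.subtype).normDet = |⟪v, w⟫_ℝ| := by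
  set T := (perpProj v).toLinearMap ∘ₗ (ℝ ∙ w)ᗮ.subtype
  set a : (ℝ ∙ w)ᗮ := perpProj w v
  have ha : ∀ y : (ℝ ∙ w)ᗮ, ⟪a, y⟫_ℝ = ⟪v, (y : E)⟫_ℝ := by
    intro y
    rw [Submodule.coe_inner, coe_perpProj hw, inner_sub_left, inner_smul_left,
      inner_eq_zero_of_perp]
    simp
  have key : T.adjoint ∘ₗ T =
      LinearMap.transvection (-(innerSL ℝ a).toLinearMap) a := by
    ext1 y
    refine ext_inner_right ℝ fun z => ?_
    rw [LinearMap.comp_apply, LinearMap.adjoint_inner_left]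
    have : ⟪T y, T z⟫_ℝ = ⟪(y : E), (z : E)⟫_ℝ - ⟪v, (y : E)⟫_ℝ * ⟪v, (z : E)⟫_ℝ :=
      inner_perpProj hv _ _
    rw [this]
    simp [LinearMap.transvection.apply, inner_add_left, inner_smul_left, ha]
    ring
  have h := T.normDet_sq
  rw [key, LinearMap.transvection.det] at h
  have h2 : (T.normDet : ℝ) ^ 2 = ⟪v, w⟫_ℝ ^ 2 := by
    have h3 : T.normDet ^ 2 = 1 + -⟪a, a⟫_ℝ := by simpa using h
    rw [h3, real_inner_self_eq_norm_sq, norm_perpProj_sq hw, hv, real_inner_comm]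
    ring
  rw [← abs_of_nonneg T.normDet_nonneg]
  exact (sq_eq_sq_iff_abs_eq_abs _ _).1 h2

variable [MeasurableSpace E] [BorelSpace E]

theorem euclideanHausdorffMeasure_perpProj_image (hm : Module.finrank ℝ E = m + 1) {v w : E}
    (hv : ‖v‖ = 1) (hw : ‖w‖ = 1) (B : Set (ℝ ∙ w)ᗮ) :
    μHE[m] ((fun y : (ℝ ∙ w)ᗮ => perpProj v (y : E)) '' B) =
      ENNReal.ofReal |⟪v, w⟫_ℝ| * μHE[m] B := by
  have h := LinearMap.euclideanHausdorffMeasure_image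
    ((perpProj v).toLinearMap ∘ₗ (ℝ ∙ w)ᗮ.subtype) B
  rw [normDet_perpProj_subtype hv hw, finrank_perp hm hw] at h
  exact h

/-- Projections of a sufficiently flat set scale its area almost as for a hyperplane, with constants
uniform as long as the direction is not almost tangent. -/
theorem exists_flat_bounds (hm : Module.finrank ℝ E = m + 1) {δ : ℝ} (hδ : 0 < δ) {K : ℝ≥0}
    (hK : 1 < K) : ∃ ε > 0, ε < δ ∧ ∀ v w : E, ‖v‖ = 1 → ‖w‖ = 1 → δ ≤ |⟪v, w⟫_ℝ| →
      ∀ A : Set E, IsFlat w ε A → InjOn (perpProj v) A ∧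
        μHE[m] (perpProj v '' A) ≤ K * (ENNReal.ofReal |⟪v, w⟫_ℝ| * μHE[m] A) ∧
        ENNReal.ofReal |⟪v, w⟫_ℝ| * μHE[m] A ≤ K * μHE[m] (perpProj v '' A) := by
  -- The lower bound on the projected area passes through `w^⊥` and loses the factor `k ^ m` twice.
  obtain ⟨k, hk1, hkK⟩ : ∃ k : ℝ≥0, 1 < k ∧ k ^ (2 * m) ≤ K := by
    have hc : Tendsto (fun k : ℝ≥0 => k ^ (2 * m)) (𝓝[>] 1) (𝓝 (1 ^ (2 * m))) :=
      ((continuous_id.pow (2 * m)).tendsto 1).mono_left nhdsWithin_le_nhds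
    rw [one_pow] at hc
    have := (hc.eventually_lt_const hK).and self_mem_nhdsWithin
    obtain ⟨k, h1, h2⟩ := this.exists
    exact ⟨k, h2, h1.le⟩
  have hk1' : (1 : ℝ) < k := by exact_mod_cast hk1
  obtain ⟨ε, hε0, hεδ, hε1, hε2, hε3, hε4⟩ : ∃ ε : ℝ, 0 < ε ∧ ε < δ ∧ ε < 1 / 2 ∧ 2 * ε / δ < 1 ∧
      1 + 2 * ε / δ < k ∧ 1 < k * (1 - 2 * ε / δ) := by
    have e1 : Tendsto (fun ε : ℝ => 2 * ε / δ) (𝓝[>] 0) (𝓝 0) := by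
      have : Continuous fun ε : ℝ => 2 * ε / δ := by fun_prop
      simpa using (this.tendsto 0).mono_left nhdsWithin_le_nhds
    have e0 : Tendsto (fun ε : ℝ => ε) (𝓝[>] 0) (𝓝 0) :=
      tendsto_id.mono_left nhdsWithin_le_nhds
    have e2 : Tendsto (fun ε : ℝ => 1 + 2 * ε / δ) (𝓝[>] 0) (𝓝 1) := by
      simpa using e1.const_add 1
    have e3 : Tendsto (fun ε : ℝ => k * (1 - 2 * ε / δ)) (𝓝[>] 0) (𝓝 k) := by
      simpa using (e1.const_sub 1).const_mul (k : ℝ)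
    have hpos : ∀ᶠ ε in 𝓝[>] (0 : ℝ), 0 < ε := self_mem_nhdsWithin
    obtain ⟨ε, h⟩ := ((((hpos.and
      (e0.eventually_lt_const hδ)).and
      (e0.eventually_lt_const one_half_pos)).and
      (e1.eventually_lt_const one_pos)).and ((e2.eventually_lt_const hk1').and
      (e3.eventually_const_lt hk1'))).exists
    exact ⟨ε, h.1.1.1.1, h.1.1.1.2, h.1.1.2, h.1.2, h.2.1, h.2.2⟩
  refine ⟨ε, hε0, hεδ, fun v w hv hw hc A hA => ?_⟩
  set c := |⟪v, w⟫_ℝ|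
  set θ := 2 * ε / δ
  have hc0 : 0 < c := hδ.trans_le hc
  have hθδ : θ * δ = 2 * ε := by simp only [θ]; field_simp
  -- the basic comparisons for a difference `z` of points of `A`
  have hz : ∀ x ∈ A, ∀ y ∈ A, ‖x - y‖ ≤ k * ‖perpProj w (x - y)‖ ∧
      ‖perpProj v (x - y)‖ ≤ k * ‖perpProj v (perpProj w (x - y) : E)‖ ∧
      ‖perpProj v (perpProj w (x - y) : E)‖ ≤ k * ‖perpProj v (x - y)‖ := by
    intro x hx y hy
    have hf := hA x hx y hy
    set z := x - y
    have h1 : (1 - ε) * ‖z‖ ≤ ‖perpProj w z‖ := by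
      refine le_of_sq_le_sq ?_ (norm_nonneg _)
      rw [norm_perpProj_sq hw]
      have : ⟪w, z⟫_ℝ ^ 2 ≤ (ε * ‖z‖) ^ 2 := sq_le_sq' (by linarith [neg_abs_le ⟪w, z⟫_ℝ])
        ((le_abs_self _).trans hf)
      nlinarith [sq_nonneg ‖z‖, mul_nonneg hε0.le (sq_nonneg ‖z‖)]
    have h2 := abs_inner_mul_norm_le_norm_perpProj hv hw (perpProj w z)
    have h3 : ‖z‖ ≤ 2 * ‖perpProj w z‖ := by nlinarith [norm_nonneg z]
    -- The flatness error becomes relative to the projected length; the bound `δ` on the obliqueness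
    -- of `v` enters here, whence `θ = 2ε/δ`.
    have h4 : ε * ‖z‖ ≤ θ * ‖perpProj v (perpProj w z : E)‖ := by
      have hθ : 0 ≤ θ := by positivity
      calc ε * ‖z‖ ≤ ε * (2 * ‖perpProj w z‖) := by gcongr
        _ = θ * (δ * ‖perpProj w z‖) := by rw [← mul_assoc θ, hθδ]; ring
        _ ≤ θ * (c * ‖perpProj w z‖) := by gcongr
        _ ≤ _ := by gcongr
    have h5 : perpProj v z - perpProj v (perpProj w z : E) = ⟪w, z⟫_ℝ • perpProj v w := by
      rw [← map_sub, coe_perpProj hw, sub_sub_cancel, map_smul]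
    have h6 : ‖perpProj v z - perpProj v (perpProj w z : E)‖ ≤ ε * ‖z‖ := by
      rw [h5, norm_smul, Real.norm_eq_abs]
      have : ‖perpProj v w‖ ≤ 1 := (norm_perpProj_le v w).trans hw.le
      calc _ ≤ |⟪w, z⟫_ℝ| * 1 := by gcongr
        _ ≤ _ := by linarith
    have h7 := norm_le_norm_add_norm_sub' (perpProj v z) (perpProj v (perpProj w z : E))
    have h8 := norm_le_norm_add_norm_sub (perpProj v z) (perpProj v (perpProj w z : E))
    have hkε : 1 ≤ k * (1 - ε) := by
      refine hε4.le.trans ?_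
      have : c ≤ 1 := by
        have := abs_real_inner_le_norm v w
        rwa [hv, hw, one_mul] at this
      have : ε ≤ θ := by
        have : 0 ≤ θ := by positivity
        nlinarith
      gcongr
    refine ⟨?_, ?_, ?_⟩
    · calc ‖z‖ = 1 * ‖z‖ := (one_mul _).symm
        _ ≤ k * (1 - ε) * ‖z‖ := by gcongr
        _ ≤ _ := by rw [mul_assoc]; gcongr
    · calc _ ≤ (1 + θ) * ‖perpProj v (perpProj w z : E)‖ := by linarith
        _ ≤ _ := by gcongr
    · calc _ ≤ k * (1 - θ) * ‖perpProj v (perpProj w z : E)‖ :=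
            le_mul_of_one_le_left (norm_nonneg _) hε4.le
        _ = k * ((1 - θ) * ‖perpProj v (perpProj w z : E)‖) := mul_assoc _ _ _
        _ ≤ _ := by gcongr; linarith
  have hscale := euclideanHausdorffMeasure_perpProj_image hm hv hw (perpProj w '' A)
  rw [image_image] at hscale
  have hA1 : μHE[m] A ≤ (k : ℝ≥0∞) ^ m * μHE[m] (perpProj w '' A) := by
    have := euclideanHausdorffMeasure_image_le_of_dist_le m (A := A) (g := perpProj w) (h := id)
      (K := k) fun x hx y hy => by
        simpa only [dist_eq_norm, ← map_sub, id] using (hz x hx y hy).1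
    simpa using this
  have hA2 : μHE[m] (perpProj v '' A) ≤
      (k : ℝ≥0∞) ^ m * μHE[m] ((fun x => perpProj v (perpProj w x : E)) '' A) :=
    euclideanHausdorffMeasure_image_le_of_dist_le m fun x hx y hy => by
      simpa only [dist_eq_norm, ← map_sub, ← Submodule.coe_sub] using (hz x hx y hy).2.1
  have hA3 : μHE[m] ((fun x => perpProj v (perpProj w x : E)) '' A) ≤
      (k : ℝ≥0∞) ^ m * μHE[m] (perpProj v '' A) :=
    euclideanHausdorffMeasure_image_le_of_dist_le m fun x hx y hy => by
      simpa only [dist_eq_norm, ← map_sub, ← Submodule.coe_sub] using (hz x hx y hy).2.2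
  have hkK' : (k : ℝ≥0∞) ^ (2 * m) ≤ K := by exact_mod_cast hkK
  have hkK2 : (k : ℝ≥0∞) ^ m ≤ K := by
    refine le_trans ?_ hkK'
    exact pow_le_pow_right₀ (by exact_mod_cast hk1.le) (by omega)
  rw [hscale] at hA2 hA3
  refine ⟨fun x hx y hy hxy => ?_, ?_, ?_⟩
  · have h := hz x hx y hy
    have h0 : ‖perpProj v (x - y)‖ = 0 := by rw [map_sub, hxy, sub_self, norm_zero]
    have h1 := abs_inner_mul_norm_le_norm_perpProj hv hw (perpProj w (x - y))
    have h2 : ‖perpProj w (x - y)‖ = 0 := by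
      have := h.2.2
      rw [h0, mul_zero] at this
      have h3 : c * ‖perpProj w (x - y)‖ ≤ 0 := h1.trans this
      nlinarith [norm_nonneg (perpProj w (x - y))]
    have h3 := h.1
    rw [h2, mul_zero] at h3
    exact sub_eq_zero.1 (norm_le_zero_iff.1 h3)
  · calc _ ≤ _ := hA2
      _ ≤ _ := by gcongr; exact euclideanHausdorffMeasure_perpProj_image_le m w A
  · calc _ ≤ ENNReal.ofReal c * ((k : ℝ≥0∞) ^ m * μHE[m] (perpProj w '' A)) := by gcongr
      _ = (k : ℝ≥0∞) ^ m * (ENNReal.ofReal c * μHE[m] (perpProj w '' A)) := by ring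
      _ ≤ (k : ℝ≥0∞) ^ m * ((k : ℝ≥0∞) ^ m * μHE[m] (perpProj v '' A)) := by gcongr
      _ = (k : ℝ≥0∞) ^ (2 * m) * μHE[m] (perpProj v '' A) := by ring
      _ ≤ _ := by gcongr

end Projection

/-! ### The mean of `|⟪v, w⟫|` over the unit sphere -/

section Sphere

variable {E : Type*} [NormedAddCommGroup E] [InnerProductSpace ℝ E] [FiniteDimensional ℝ E]
  [MeasurableSpace E] [BorelSpace E] {m : ℕ}

/-- The cone over this great subsphere lies in the hyperplane `w^⊥`, which is Lebesgue null. -/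
theorem toSphere_inner_eq_zero {w : E} (hw : ‖w‖ = 1) :
    (volume : Measure E).toSphere {v | ⟪(v : E), w⟫_ℝ = 0} = 0 := by
  have hmeas : MeasurableSet {v : Metric.sphere (0 : E) 1 | ⟪(v : E), w⟫_ℝ = 0} :=
    measurableSet_eq_fun (by fun_prop) measurable_const
  rw [Measure.toSphere_apply' _ hmeas]
  have hnull : volume ((ℝ ∙ w)ᗮ : Set E) = 0 := by
    refine Measure.addHaar_submodule _ _ fun h => ?_
    have : w ∈ (ℝ ∙ w)ᗮ := h ▸ Submodule.mem_top
    have := Submodule.mem_orthogonal_singleton_iff_inner_right.1 this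
    rw [real_inner_self_eq_norm_sq, hw] at this
    norm_num at this
  rw [measure_mono_null _ hnull, mul_zero]
  rintro _ ⟨r, -, _, ⟨v, hv, rfl⟩, rfl⟩
  refine Submodule.smul_mem _ _ (Submodule.mem_orthogonal_singleton_iff_inner_right.2 ?_)
  rw [real_inner_comm]
  exact hv

/-- The directions almost orthogonal to `w` have small measure. -/
theorem exists_toSphere_abs_inner_lt_le {w : E} (hw : ‖w‖ = 1) {η : ℝ≥0∞} (hη : 0 < η) :
    ∃ δ > 0, (volume : Measure E).toSphere {v | |⟪(v : E), w⟫_ℝ| < δ} ≤ η := by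
  let s : ℝ → Set (Metric.sphere (0 : E) 1) := fun δ => {v | |⟪(v : E), w⟫_ℝ| < δ}
  have h := tendsto_measure_biInter_gt (μ := (volume : Measure E).toSphere) (s := s) (a := 0)
    (fun r _ => (measurableSet_lt (by fun_prop) measurable_const).nullMeasurableSet)
    (fun i j _ hij v hv => lt_of_lt_of_le (show _ < i from hv) hij)
    ⟨1, one_pos, measure_ne_top _ _⟩
  have hs : (⋂ r > 0, s r) = {v : Metric.sphere (0 : E) 1 | ⟪(v : E), w⟫_ℝ = 0} := by
    ext v
    simp only [mem_iInter, s, mem_ofPred_eq]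
    refine ⟨fun h => abs_nonpos_iff.1 (le_of_forall_gt fun r hr => h r hr), fun h r hr => ?_⟩
    rwa [h, abs_zero]
  rw [hs, toSphere_inner_eq_zero hw] at h
  have hpos : ∀ᶠ δ in 𝓝[>] (0 : ℝ), 0 < δ := self_mem_nhdsWithin
  obtain ⟨δ, h1, h2⟩ := (hpos.and (h.eventually_lt_const hη)).exists
  exact ⟨δ, h1, h2.le⟩

/-- Fubini along the splitting into `ℝw` and `w^⊥`: the line contributes `2 ∫ r exp(-r²) dr = 1`
over `r > 0`, and `w^⊥` a Gaussian integral in `m` variables. -/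
theorem integral_abs_inner_mul_exp_neg_sq (hm : Module.finrank ℝ E = m + 1) {w : E}
    (hw : ‖w‖ = 1) :
    ∫ x : E, |⟪x, w⟫_ℝ| * Real.exp (-‖x‖ ^ 2) = Real.pi ^ (m / 2 : ℝ) := by
  set K := ℝ ∙ w
  have hK1 : Module.finrank ℝ K = 1 :=
    finrank_span_singleton (norm_ne_zero_iff.1 (by simp [hw]))
  have : Nontrivial K := Module.nontrivial_of_finrank_pos (R := ℝ) (by omega)
  have hmp := K.measurePreserving_measurableEquivProd (0 : E)
  rw [InnerProductSpace.euclideanHausdorffMeasure_eq_volume] at hmp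
  have h1 := hmp.integral_comp' (fun q : K × Kᗮ =>
    (‖q.1‖ * Real.exp (-‖q.1‖ ^ 2)) * Real.exp (-1 * ‖q.2‖ ^ 2))
  have h2 : ∀ x : E, |⟪x, w⟫_ℝ| * Real.exp (-‖x‖ ^ 2) =
      (‖(K.measurableEquivProd (0 : E) x).1‖ *
        Real.exp (-‖(K.measurableEquivProd (0 : E) x).1‖ ^ 2)) *
        Real.exp (-1 * ‖(K.measurableEquivProd (0 : E) x).2‖ ^ 2) := by
    intro x
    have h3 : (K.orthogonalProjectionOnto x : E) = ⟪w, x⟫_ℝ • w :=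
      Submodule.starProjection_unit_singleton ℝ hw x
    have h4 : ‖K.orthogonalProjectionOnto x‖ = |⟪w, x⟫_ℝ| := by
      rw [← Submodule.norm_coe, h3, norm_smul, hw, mul_one, Real.norm_eq_abs]
    have h5 := norm_perpProj_sq hw x
    simp only [Submodule.measurableEquivProd_apply, vsub_eq_sub, sub_zero]
    change _ = _ * Real.exp (-1 * ‖perpProj w x‖ ^ 2)
    rw [h4, h5, mul_assoc, ← Real.exp_add, real_inner_comm, sq_abs]
    ring_nf
  simp_rw [h2]
  rw [h1, Measure.volume_eq_prod,
    integral_prod_mul (fun q : K => ‖q‖ * Real.exp (-‖q‖ ^ 2))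
      (fun q : Kᗮ => Real.exp (-1 * ‖q‖ ^ 2)),
    GaussianFourier.integral_rexp_neg_mul_sq_norm one_pos,
    integral_fun_norm_addHaar volume (fun r => r * Real.exp (-r ^ 2)), hK1, finrank_perp hm hw]
  have h6 := integral_rpow_mul_exp_neg_rpow (p := 2) (q := 1) (by norm_num) (by norm_num)
  have h7 : (volume : Measure K).real (Metric.ball 0 1) = 2 := by
    rw [measureReal_def, InnerProductSpace.volume_ball, hK1, Real.Gamma_add_one (by norm_num),
      Nat.cast_one, Real.Gamma_one_half_eq]
    have : √Real.pi ≠ 0 := (Real.sqrt_pos.2 Real.pi_pos).ne'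
    have h9 : √Real.pi / (2⁻¹ * √Real.pi) = 2 := by field_simp
    simp [h9]
  have h8 : ∫ y in Ioi (0 : ℝ), y ^ (1 - 1) • (y * Real.exp (-y ^ 2)) = 1 / 2 := by
    norm_num at h6
    simpa using h6
  rw [h7, h8]
  simp

/-- In polar coordinates the preceding Gaussian integral is the spherical integral times the radial
factor `Γ(m/2 + 1) / 2`; dividing leaves `2 π^(m/2) / Γ(m/2 + 1)`. -/
theorem integral_abs_inner_toSphere (hm : Module.finrank ℝ E = m + 1) {w : E} (hw : ‖w‖ = 1) :
    ∫ v : Metric.sphere (0 : E) 1, |⟪(v : E), w⟫_ℝ| ∂(volume : Measure E).toSphere =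
      2 * ballVolume m := by
  have : Nontrivial E := Module.nontrivial_of_finrank_pos (R := ℝ) (by omega)
  have h0 := integral_abs_inner_mul_exp_neg_sq hm hw
  have hpolar : ∫ x : E, |⟪x, w⟫_ℝ| * Real.exp (-‖x‖ ^ 2) =
      (∫ v : Metric.sphere (0 : E) 1, |⟪(v : E), w⟫_ℝ| ∂(volume : Measure E).toSphere) *
        ∫ r : Ioi (0 : ℝ), r * Real.exp (-(r : ℝ) ^ 2) ∂.volumeIoiPow m := by
    rw [← integral_prod_mul (μ := (volume : Measure E).toSphere)
      (ν := Measure.volumeIoiPow m)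
      (fun v => |⟪(v : E), w⟫_ℝ|) (fun r : Ioi (0 : ℝ) => r * Real.exp (-(r : ℝ) ^ 2))]
    have h := ((volume : Measure E).measurePreserving_homeomorphUnitSphereProd).integral_comp
      (Homeomorph.measurableEmbedding _) (fun z : Metric.sphere (0 : E) 1 × Ioi (0 : ℝ) =>
        |⟪(z.1 : E), w⟫_ℝ| * (z.2 * Real.exp (-(z.2 : ℝ) ^ 2)))
    rw [hm, Nat.add_sub_cancel] at h
    have h2 := integral_subtype_comap (μ := (volume : Measure E)) (measurableSet_singleton 0).compl
      (fun x : E => |⟪x, w⟫_ℝ| * Real.exp (-‖x‖ ^ 2))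
    rw [restrict_compl_singleton] at h2
    rw [← h, ← h2]
    refine integral_congr_ae (Eventually.of_forall fun x => ?_)
    have hx : ‖(x : E)‖ ≠ 0 := norm_ne_zero_iff.2 x.2
    simp only [homeomorphUnitSphereProd_apply_fst_coe, homeomorphUnitSphereProd_apply_snd_coe,
      inner_smul_left, abs_mul]
    simp
    field_simp
  have hrad : ∫ r : Ioi (0 : ℝ), r * Real.exp (-(r : ℝ) ^ 2) ∂.volumeIoiPow m =
      Real.Gamma (m / 2 + 1) / 2 := by
    simp only [Measure.volumeIoiPow, ENNReal.ofReal]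
    rw [integral_withDensity_eq_integral_smul (measurable_subtype_coe.pow_const _).real_toNNReal,
      integral_subtype_comap measurableSet_Ioi
        fun a => Real.toNNReal (a ^ m) • (a * Real.exp (-a ^ 2))]
    have h6 := integral_rpow_mul_exp_neg_rpow (p := 2) (q := m + 1) (by norm_num)
      (by linarith [m.cast_nonneg (α := ℝ)])
    have h7 : ((m : ℝ) + 1 + 1) / 2 = m / 2 + 1 := by ring
    rw [h7] at h6
    rw [← mul_one_div, mul_comm, ← h6]
    refine setIntegral_congr_fun measurableSet_Ioi fun x hx => ?_
    have hx : 0 < x := hx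
    rw [NNReal.smul_def, Real.coe_toNNReal _ (by positivity), smul_eq_mul]
    norm_cast
    ring
  have hG : 0 < Real.Gamma (m / 2 + 1) := Real.Gamma_pos_of_pos (by positivity)
  have hball : ballVolume m = Real.pi ^ (m / 2 : ℝ) / Real.Gamma (m / 2 + 1) := by
    rcases m.eq_zero_or_pos with rfl | hm0
    · simp [ballVolume, measureReal_def, volume_euclideanSpace_eq_dirac]
    have : Nontrivial (EuclideanSpace ℝ (Fin m)) :=
      Module.nontrivial_of_finrank_pos (R := ℝ) (by simpa using hm0)
    rw [ballVolume, measureReal_def, InnerProductSpace.volume_ball, finrank_euclideanSpace_fin,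
      ENNReal.toReal_mul, ENNReal.toReal_ofReal (by positivity), Real.sqrt_eq_rpow,
      ← Real.rpow_natCast, ← Real.rpow_mul Real.pi_pos.le]
    simp
    ring_nf
  rw [hpolar, hrad] at h0
  rw [hball, ← h0, mul_div_assoc, div_right_comm, div_self hG.ne']
  ring

theorem lintegral_abs_inner_toSphere (hm : Module.finrank ℝ E = m + 1) {w : E} (hw : ‖w‖ = 1) :
    ∫⁻ v : Metric.sphere (0 : E) 1, ENNReal.ofReal |⟪(v : E), w⟫_ℝ|
      ∂(volume : Measure E).toSphere = ENNReal.ofReal (2 * ballVolume m) := by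
  rw [← integral_abs_inner_toSphere hm hw, ofReal_integral_eq_lintegral_ofReal]
  · refine Integrable.of_bound (Continuous.aestronglyMeasurable (by fun_prop)) 1 ?_
    refine Eventually.of_forall fun v => ?_
    have := abs_real_inner_le_norm (v : E) w
    simpa [hw] using this
  · exact Eventually.of_forall fun v => abs_nonneg _

end Sphere

/-! ### Measurability of intersection counts and Eilenberg's inequality -/

section Counting

theorem lt_count_iff {α : Type*} [MeasurableSpace α] [MeasurableSingletonClass α] {s : Set α}
    {a : ℝ≥0∞} : a < Measure.count s ↔ ∃ F : Finset α, (F : Set α) ⊆ s ∧ a < F.card := by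
  refine ⟨fun h => ?_, fun ⟨F, hF, ha⟩ => ?_⟩
  · by_cases hs : s.Finite
    · refine ⟨hs.toFinset, by simp, ?_⟩
      rwa [Measure.count_apply_finite s hs] at h
    · obtain ⟨r, hr⟩ := ENNReal.exists_nat_gt h.ne_top
      obtain ⟨t, ht, rfl⟩ := Set.Infinite.exists_subset_card_eq hs r
      exact ⟨t, ht, hr⟩
  · rw [← Measure.count_apply_finset] at ha
    exact ha.trans_le (measure_mono hF)

theorem exists_pos_le_dist_of_finset {α : Type*} [MetricSpace α] (F : Finset α) :
    ∃ d > 0, ∀ x ∈ F, ∀ y ∈ F, x ≠ y → d ≤ dist x y := by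
  by_cases h : (F : Set α).Nontrivial
  · exact ⟨_, F.infsep_pos_iff_nontrivial.2 h, fun x hx y hy hxy =>
      Set.infsep_le_dist_of_mem hx hy hxy⟩
  · rw [Set.not_nontrivial_iff] at h
    exact ⟨1, one_pos, fun x hx y hy hxy => (hxy (h hx hy)).elim⟩

variable {n : ℕ}

theorem OrientedLine.mem_points_iff {l : OrientedLine n} {x : EuclideanSpace ℝ (Fin n)} :
    x ∈ l.points ↔ x - ⟪l.dir, x⟫_ℝ • l.dir = l.foot := by
  have hd : ‖l.dir‖ = 1 := l.2.1
  have hp : ⟪l.dir, l.foot⟫_ℝ = 0 := l.2.2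
  constructor
  · rintro ⟨t, rfl⟩
    simp [inner_add_right, inner_smul_right, hp, hd]
  · intro h
    refine ⟨⟪l.dir, x⟫_ℝ, ?_⟩
    simp only [← h]
    abel

theorem OrientedLine.mem_points_mk_iff {v : Metric.sphere (0 : EuclideanSpace ℝ (Fin n)) 1}
    {p : (ℝ ∙ (v : EuclideanSpace ℝ (Fin n)))ᗮ} {x : EuclideanSpace ℝ (Fin n)} :
    x ∈ (OrientedLine.mk v p).points ↔ perpProj (v : EuclideanSpace ℝ (Fin n)) x = p := by
  rw [OrientedLine.mem_points_iff, Subtype.ext_iff, coe_perpProj (norm_eq_of_mem_sphere v)]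
  rfl

/-- Projecting along the compact factor `K ^ r` preserves closedness. Separation by a fixed `d`
replaces distinctness, which is not a closed condition. -/
theorem isClosed_setOf_separated_points {K : Set (EuclideanSpace ℝ (Fin n))} (hK : IsCompact K)
    (r : ℕ) (d : ℝ) : IsClosed {l : OrientedLine n | ∃ x : Fin r → K,
      (∀ i, (x i : EuclideanSpace ℝ (Fin n)) ∈ l.points) ∧ ∀ i j, i ≠ j → d ≤ dist (x i) (x j)} := by
  have : CompactSpace K := isCompact_iff_compactSpace.1 hK
  have hcl : IsClosed {q : (Fin r → K) × OrientedLine n |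
      (∀ i, (q.1 i : EuclideanSpace ℝ (Fin n)) ∈ q.2.points) ∧
        ∀ i j, i ≠ j → d ≤ dist (q.1 i) (q.1 j)} := by
    have hdir : Continuous fun q : (Fin r → K) × OrientedLine n => q.2.dir :=
      continuous_fst.comp (continuous_subtype_val.comp continuous_snd)
    have hfoot : Continuous fun q : (Fin r → K) × OrientedLine n => q.2.foot :=
      continuous_snd.comp (continuous_subtype_val.comp continuous_snd)
    simp only [OrientedLine.mem_points_iff]
    simp only [ofPred_and, ofPred_forall]
    refine IsClosed.inter (isClosed_iInter fun i => isClosed_eq (by fun_prop) hfoot)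
      (isClosed_iInter fun i => isClosed_iInter fun j => isClosed_iInter fun _ =>
        isClosed_le continuous_const (by fun_prop))
  convert isClosedMap_snd_of_compactSpace _ hcl using 1
  ext l
  simp

theorem measurable_count_points_inter {K : Set (EuclideanSpace ℝ (Fin n))} (hK : IsCompact K) :
    Measurable fun l : OrientedLine n => Measure.count (l.points ∩ K) := by
  refine measurable_of_Ioi fun a => ?_
  -- More than `a` points means some `r > a` points with mutual distances at least some `1 / (k +
  -- 1)`: a countable union of closed sets.
  have : (fun l : OrientedLine n => Measure.count (l.points ∩ K)) ⁻¹' Ioi a =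
      ⋃ r : {r : ℕ // a < r}, ⋃ k : ℕ, {l : OrientedLine n | ∃ x : Fin r → K,
        (∀ i, (x i : EuclideanSpace ℝ (Fin n)) ∈ l.points) ∧
          ∀ i j, i ≠ j → 1 / ((k : ℝ) + 1) ≤ dist (x i) (x j)} := by
    ext l
    simp only [mem_preimage, mem_Ioi, lt_count_iff, mem_iUnion, mem_ofPred_eq]
    constructor
    · rintro ⟨F, hF, ha⟩
      obtain ⟨d, hd, hF'⟩ := exists_pos_le_dist_of_finset F
      obtain ⟨k, hk⟩ := exists_nat_one_div_lt hd
      let e := F.equivFin.symm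
      refine ⟨⟨F.card, ha⟩, k, fun i => ⟨e i, (hF (e i).2).2⟩, fun i => (hF (e i).2).1,
        fun i j hij => hk.le.trans ?_⟩
      exact hF' _ (e i).2 _ (e j).2 fun h => hij (e.injective (Subtype.ext h))
    · rintro ⟨⟨r, hr⟩, k, x, hx, hd⟩
      classical
      have hinj : Function.Injective fun i => (x i : EuclideanSpace ℝ (Fin n)) := by
        intro i j hij
        by_contra hne
        have h1 := hd i j hne
        rw [Subtype.dist_eq, show (x i : EuclideanSpace ℝ (Fin n)) = x j from hij, dist_self] at h1
        have : 0 < 1 / ((k : ℝ) + 1) := by positivity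
        linarith
      refine ⟨Finset.univ.image fun i => (x i : EuclideanSpace ℝ (Fin n)), ?_, ?_⟩
      · intro y hy
        obtain ⟨i, -, rfl⟩ := Finset.mem_image.1 hy
        exact ⟨hx i, (x i).2⟩
      · rw [Finset.card_image_of_injective _ hinj]
        simpa using hr
  rw [this]
  exact .iUnion fun r => .iUnion fun k => (isClosed_setOf_separated_points hK _ _).measurableSet

/-- The upper integral of the number of points in the fibres of the projection along `v` is at
most the area (Eilenberg's inequality). -/
theorem lintegral_count_fiber_le {E : Type*} [NormedAddCommGroup E] [InnerProductSpace ℝ E]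
    [FiniteDimensional ℝ E] [MeasurableSpace E] [BorelSpace E] (m : ℕ) (v : E) {A : Set E}
    (hA : MeasurableSet A) :
    ∫⁻ p : (ℝ ∙ v)ᗮ, Measure.count ({x | perpProj v x = p} ∩ A) ∂μHE[m] ≤ μHE[m] A := by
  have hpart := fun k : ℕ => SeparableSpace.exists_measurable_partition_diam_le E
    (ε := 1 / ((k : ℝ) + 1)) (by positivity)
  choose P hPm hPb hPd hPu hPdisj using hpart
  -- Measurable hulls have the same measure as the projections, whose own measurability is then not
  -- needed.
  let T : ℕ → ℕ → Set (ℝ ∙ v)ᗮ := fun k j => toMeasurable μHE[m] (perpProj v '' (A ∩ P k j))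
  have hT : ∀ k j, MeasurableSet (T k j) := fun k j => measurableSet_toMeasurable _ _
  let g : ℕ → (ℝ ∙ v)ᗮ → ℝ≥0∞ := fun k p => ∑' j, (T k j).indicator 1 p
  have hg : ∀ k, Measurable (g k) := fun k =>
    Measurable.tsum fun j => measurable_one.indicator (hT k j)
  have hgint : ∀ k, ∫⁻ p, g k p ∂μHE[m] ≤ μHE[m] A := by
    intro k
    calc ∫⁻ p, g k p ∂μHE[m] = ∑' j, μHE[m] (perpProj v '' (A ∩ P k j)) := by
          rw [lintegral_tsum fun j => (measurable_one.indicator (hT k j)).aemeasurable]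
          refine tsum_congr fun j => ?_
          rw [lintegral_indicator_one (hT k j), measure_toMeasurable]
      _ ≤ ∑' j, μHE[m] (A ∩ P k j) :=
          ENNReal.tsum_le_tsum fun j => euclideanHausdorffMeasure_perpProj_image_le m v _
      _ = μHE[m] (⋃ j, A ∩ P k j) := by
          rw [measure_iUnion _ fun j => hA.inter (hPm k j)]
          exact fun i j hij => (hPdisj k hij).mono inter_subset_right inter_subset_right
      _ = μHE[m] A := by rw [← inter_iUnion, hPu, inter_univ]
  -- Finitely many points of a fibre lie in different cells once the mesh is below their least
  -- distance, so `g k` eventually counts them all; Fatou's lemma concludes.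
  calc _ ≤ ∫⁻ p, liminf (fun k => g k p) atTop ∂μHE[m] := by
        refine lintegral_mono fun p => le_of_forall_lt fun a ha => ?_
        obtain ⟨F, hF, haF⟩ := lt_count_iff.1 ha
        refine haF.trans_le (le_liminf_of_le (by isBoundedDefault) ?_)
        obtain ⟨d, hd, hFd⟩ := exists_pos_le_dist_of_finset F
        obtain ⟨k₀, hk₀⟩ := exists_nat_one_div_lt hd
        filter_upwards [eventually_ge_atTop k₀] with k hk
        have hkd : 1 / ((k : ℝ) + 1) < d := (Nat.one_div_le_one_div hk).trans_lt hk₀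
        have hex : ∀ x, ∃ j, x ∈ P k j := fun x => mem_iUnion.1 (hPu k ▸ mem_univ x)
        choose i hi using hex
        have hinj : Set.InjOn i F := by
          intro x hx y hy hxy
          by_contra hne
          have h1 := Metric.dist_le_diam_of_mem (hPb k (i x)) (hi x) (hxy ▸ hi y)
          linarith [hFd x hx y hy hne, hPd k (i x)]
        calc (F.card : ℝ≥0∞) = ∑ j ∈ F.image i, 1 := by
              rw [Finset.sum_const, Finset.card_image_of_injOn hinj, nsmul_one]
          _ ≤ ∑ j ∈ F.image i, (T k j).indicator 1 p := by
              refine Finset.sum_le_sum fun j hj => ?_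
              obtain ⟨x, hx, rfl⟩ := Finset.mem_image.1 hj
              rw [indicator_of_mem, Pi.one_apply]
              exact subset_toMeasurable _ _ ⟨x, ⟨(hF hx).2, hi x⟩, (hF hx).1⟩
          _ ≤ g k p := ENNReal.sum_le_tsum _
    _ ≤ liminf (fun k => ∫⁻ p, g k p ∂μHE[m]) atTop := lintegral_liminf_le hg
    _ ≤ liminf (fun _ : ℕ => μHE[m] A) atTop := liminf_le_liminf (Eventually.of_forall hgint)
    _ = μHE[m] A := liminf_const _

end Counting

/-! ### Counting measure on intersections as a measurable kernel -/

section Kernel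

open ProbabilityTheory

variable {n : ℕ} {M : Set (EuclideanSpace ℝ (Fin n))}

open Classical in
/-- The counting measure on the intersection of a line with a compact set `M`, or `0` if this
intersection is infinite. -/
def intersectionKernel (hM : IsCompact M) : Kernel (OrientedLine n) (EuclideanSpace ℝ (Fin n)) where
  toFun l := if Measure.count (l.points ∩ M) < ⊤ then Measure.count.restrict (l.points ∩ M) else 0
  measurable' := by
    have hfin : ∀ l : OrientedLine n, IsFiniteMeasure (if Measure.count (l.points ∩ M) < ⊤ then
        Measure.count.restrict (l.points ∩ M) else 0) := by
      intro l
      split_ifs with h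
      · exact ⟨by simpa using h⟩
      · infer_instance
    have hgood : MeasurableSet {l : OrientedLine n | Measure.count (l.points ∩ M) < ⊤} :=
      measurableSet_lt (measurable_count_points_inter hM) measurable_const
    have hclosed : ∀ s : Set (EuclideanSpace ℝ (Fin n)), IsClosed s →
        Measurable fun l : OrientedLine n => (if Measure.count (l.points ∩ M) < ⊤ then
          Measure.count.restrict (l.points ∩ M) else 0) s := by
      intro s hs
      have : (fun l : OrientedLine n => (if Measure.count (l.points ∩ M) < ⊤ then
          Measure.count.restrict (l.points ∩ M) else 0) s) = fun l : OrientedLine n =>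
          if Measure.count (l.points ∩ M) < ⊤ then Measure.count (l.points ∩ (M ∩ s)) else 0 := by
        ext l
        split_ifs
        · rw [Measure.restrict_apply hs.measurableSet]
          congr 1
          ext x
          simp only [mem_inter_iff]
          tauto
        · rfl
      rw [this]
      exact Measurable.ite hgood (measurable_count_points_inter (hM.inter_right hs))
        measurable_const
    exact Measurable.measure_of_isPiSystem
      -- Testing on the π-system of closed sets requires finite measures; this is why the kernel is
      -- cut off to `0` on infinite intersections.
      (BorelSpace.measurable_eq.trans borel_eq_generateFrom_isClosed) isPiSystem_isClosed
      hclosed (hclosed _ isClosed_univ)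

theorem intersectionKernel_apply_of_lt_top (hM : IsCompact M) {l : OrientedLine n}
    (h : Measure.count (l.points ∩ M) < ⊤) :
    intersectionKernel hM l = Measure.count.restrict (l.points ∩ M) :=
  if_pos h

theorem intersectionKernel_apply_le (hM : IsCompact M) (l : OrientedLine n)
    {A : Set (EuclideanSpace ℝ (Fin n))} (hA : MeasurableSet A) :
    intersectionKernel hM l A ≤ Measure.count (l.points ∩ (M ∩ A)) := by
  by_cases h : Measure.count (l.points ∩ M) < ⊤
  · rw [intersectionKernel_apply_of_lt_top hM h, Measure.restrict_apply hA]
    exact measure_mono fun x hx => ⟨hx.2.1, hx.2.2, hx.1⟩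
  · have : intersectionKernel hM l = 0 := if_neg h
    simp [this]

theorem intersectionKernel_ne_zero_iff (hM : IsCompact M) {l : OrientedLine n}
    (h : Measure.count (l.points ∩ M) < ⊤) {A : Set (EuclideanSpace ℝ (Fin n))}
    (hA : MeasurableSet A) :
    intersectionKernel hM l A ≠ 0 ↔ (A ∩ (l.points ∩ M)).Nonempty := by
  rw [intersectionKernel_apply_of_lt_top hM h, Measure.restrict_apply hA,
    Measure.count_ne_zero_iff]

theorem one_le_intersectionKernel (hM : IsCompact M) {l : OrientedLine n}
    {A : Set (EuclideanSpace ℝ (Fin n))} (hA : MeasurableSet A)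
    (h : intersectionKernel hM l A ≠ 0) : 1 ≤ intersectionKernel hM l A := by
  by_cases hl : Measure.count (l.points ∩ M) < ⊤
  · obtain ⟨x, hx⟩ := (intersectionKernel_ne_zero_iff hM hl hA).1 h
    rw [intersectionKernel_apply_of_lt_top hM hl, Measure.restrict_apply hA]
    calc (1 : ℝ≥0∞) = Measure.count {x} := by simp
      _ ≤ _ := measure_mono (by simpa using hx)
  · have : intersectionKernel hM l = 0 := if_neg hl
    simp [this] at h

end Kernel

/-! ### Crossing counts for parallel lines, and their average over directions -/

section Fibers

variable {m : ℕ} {M : Set (EuclideanSpace ℝ (Fin (m + 1)))}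

local notation "𝔼" => EuclideanSpace ℝ (Fin (m + 1))
local notation "𝕊" => Metric.sphere (0 : EuclideanSpace ℝ (Fin (m + 1))) 1

theorem volume_perp_eq (v : 𝕊) :
    (volume : Measure (ℝ ∙ (v : 𝔼))ᗮ) = μHE[m] := by
  rw [← InnerProductSpace.euclideanHausdorffMeasure_eq_volume,
    finrank_perp finrank_euclideanSpace_fin (norm_eq_of_mem_sphere v)]

theorem points_mk_eq (v : 𝕊) (p : (ℝ ∙ (v : 𝔼))ᗮ) :
    (OrientedLine.mk v p).points = {x | perpProj (v : 𝔼) x = p} := by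
  ext x
  exact OrientedLine.mem_points_mk_iff

theorem lintegral_intersectionKernel_mk_le (hM : IsCompact M) (v : 𝕊) {A : Set 𝔼}
    (hA : MeasurableSet A) :
    ∫⁻ p, intersectionKernel hM (OrientedLine.mk v p) A ≤ μHE[m] (M ∩ A) := by
  rw [volume_perp_eq]
  refine le_trans (lintegral_mono fun p => ?_)
    (lintegral_count_fiber_le m (v : 𝔼) (hM.measurableSet.inter hA))
  rw [← points_mk_eq]
  exact intersectionKernel_apply_le hM _ hA

theorem ae_count_points_mk_lt_top (hM : IsCompact M) (hfin : μHE[m] M < ⊤) (v : 𝕊) :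
    ∀ᵐ p, Measure.count ((OrientedLine.mk v p).points ∩ M) < ⊤ := by
  refine ae_lt_top ((measurable_count_points_inter hM).comp (measurable_mk v)) (ne_of_lt ?_)
  refine lt_of_le_of_lt ?_ hfin
  rw [volume_perp_eq]
  simp only [points_mk_eq]
  exact lintegral_count_fiber_le m (v : 𝔼) hM.measurableSet

theorem lintegral_intersectionKernel_mk_le_of_injOn (hM : IsCompact M) (v : 𝕊) {A : Set 𝔼}
    (hA : MeasurableSet A) (hinj : InjOn (perpProj (v : 𝔼)) A) :
    ∫⁻ p, intersectionKernel hM (OrientedLine.mk v p) A ≤ μHE[m] (perpProj (v : 𝔼) '' A) := by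
  rw [volume_perp_eq, ← measure_toMeasurable (perpProj (v : 𝔼) '' A),
    ← lintegral_indicator_one (measurableSet_toMeasurable _ _)]
  refine lintegral_mono fun p => (intersectionKernel_apply_le hM _ hA).trans ?_
  rw [points_mk_eq]
  by_cases hp : p ∈ perpProj (v : 𝔼) '' A
  · rw [indicator_of_mem (subset_toMeasurable _ _ hp)]
    have hsub : ({x | perpProj (v : 𝔼) x = p} ∩ (M ∩ A)).Subsingleton :=
      fun x hx y hy => hinj hx.2.2 hy.2.2 (hx.1.trans hy.1.symm)
    rcases hsub.eq_empty_or_singleton with h | ⟨x, h⟩ <;> simp [h]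
  · have hempty : {x | perpProj (v : 𝔼) x = p} ∩ (M ∩ A) = ∅ :=
      eq_empty_of_forall_notMem fun x hx => hp ⟨x, hx.2.2, hx.1⟩
    simp [hempty]

/-- Markov's inequality at level `1`: almost every line over the projection of `A` meets `A` and so
has count at least `1`. Finite area discards the lines on which the kernel was cut off. -/
theorem le_lintegral_intersectionKernel_mk (hM : IsCompact M) (hfin : μHE[m] M < ⊤) (v : 𝕊)
    {A : Set 𝔼} (hA : MeasurableSet A) (hAM : A ⊆ M) :
    μHE[m] (perpProj (v : 𝔼) '' A) ≤ ∫⁻ p, intersectionKernel hM (OrientedLine.mk v p) A := by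
  have hmeas : Measurable fun p => intersectionKernel hM (OrientedLine.mk v p) A :=
    ((intersectionKernel hM).measurable_coe hA).comp (measurable_mk v)
  have hmarkov := mul_meas_ge_le_lintegral (μ := volume) hmeas 1
  rw [one_mul] at hmarkov
  refine le_trans ?_ hmarkov
  rw [← volume_perp_eq]
  refine measure_mono_ae ?_
  filter_upwards [ae_count_points_mk_lt_top hM hfin v] with p hp hpA
  obtain ⟨x, hx, rfl⟩ := hpA
  refine one_le_intersectionKernel hM hA ((intersectionKernel_ne_zero_iff hM hp hA).2 ?_)
  exact ⟨x, hx, OrientedLine.mem_points_mk_iff.2 rfl, hAM hx⟩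

/-- The average number of intersection points with lines, as a measure on `M`. -/
def crossingMeasure (hM : IsCompact M) : Measure 𝔼 :=
  (kinematicMeasure (m + 1)).bind (intersectionKernel hM)

theorem crossingMeasure_apply (hM : IsCompact M) {A : Set 𝔼} (hA : MeasurableSet A) :
    crossingMeasure hM A = ∫⁻ v : 𝕊, (∫⁻ p, intersectionKernel hM (OrientedLine.mk v p) A)
      ∂(volume : Measure 𝔼).toSphere := by
  rw [crossingMeasure, Measure.bind_apply hA (intersectionKernel hM).aemeasurable,
    lintegral_kinematicMeasure ((intersectionKernel hM).measurable_coe hA)]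

theorem crossingMeasure_le (hM : IsCompact M) {A : Set 𝔼} (hA : MeasurableSet A) :
    crossingMeasure hM A ≤ (volume : Measure 𝔼).toSphere univ * μHE[m] (M ∩ A) := by
  rw [crossingMeasure_apply hM hA, mul_comm, ← lintegral_const]
  exact lintegral_mono fun v => lintegral_intersectionKernel_mk_le hM v hA

theorem kinematicMeasure_apply {A : Set (OrientedLine (m + 1))} (hA : MeasurableSet A) :
    kinematicMeasure (m + 1) A = ∫⁻ v : 𝕊, volume (OrientedLine.mk v ⁻¹' A)
      ∂(volume : Measure 𝔼).toSphere := by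
  rw [← lintegral_indicator_one hA, lintegral_kinematicMeasure (measurable_one.indicator hA)]
  refine lintegral_congr fun v => ?_
  rw [← lintegral_indicator_one (measurable_mk v hA)]
  rfl

theorem ae_count_points_lt_top (hM : IsCompact M) (hfin : μHE[m] M < ⊤) :
    ∀ᵐ l ∂kinematicMeasure (m + 1), Measure.count (l.points ∩ M) < ⊤ := by
  have hgood : MeasurableSet {l : OrientedLine (m + 1) | Measure.count (l.points ∩ M) < ⊤} :=
    measurableSet_lt (measurable_count_points_inter hM) measurable_const
  rw [ae_iff, ← compl_ofPred, kinematicMeasure_apply hgood.compl]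
  refine (lintegral_congr fun v => ?_).trans lintegral_zero
  exact ae_iff.1 (ae_count_points_mk_lt_top hM hfin v)

/-- The average number of intersections of a sufficiently flat set with lines is close to its area,
up to the constant factor, and few lines cross it almost tangentially. -/
theorem exists_crossingMeasure_flat_bounds (hM : IsCompact M) (hfin : μHE[m] M < ⊤) {w : 𝔼}
    (hw : ‖w‖ = 1) {η : ℝ≥0} (hη : 0 < η) : ∃ ε > 0, ∀ A ⊆ M, MeasurableSet A → IsFlat w ε A →
      crossingMeasure hM A ≤ (ENNReal.ofReal (2 * ballVolume m) + η) * μHE[m] A ∧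
      ENNReal.ofReal (2 * ballVolume m) * μHE[m] A ≤ crossingMeasure hM A + η * μHE[m] A ∧
      kinematicMeasure (m + 1) {l | |⟪l.dir, w⟫_ℝ| ≤ ε ∧ intersectionKernel hM l A ≠ 0} ≤
        η * μHE[m] A := by
  set σ := (volume : Measure 𝔼).toSphere
  set C := ENNReal.ofReal (2 * ballVolume m)
  have hCint : ∫⁻ v : 𝕊, ENNReal.ofReal |⟪(v : 𝔼), w⟫_ℝ| ∂σ = C :=
    lintegral_abs_inner_toSphere finrank_euclideanSpace_fin hw
  have hη2 : (0 : ℝ≥0∞) < (η / 2 : ℝ≥0) := by exact_mod_cast half_pos hη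
  obtain ⟨δ, hδ, hB⟩ := exists_toSphere_abs_inner_lt_le hw hη2
  set B : Set 𝕊 := {v | |⟪(v : 𝔼), w⟫_ℝ| < δ}
  have hBm : MeasurableSet B := measurableSet_lt (by fun_prop) measurable_const
  -- The factor `1 + τ` is the distortion off the band `B`. The bound on `τ * C` serves the upper
  -- estimate, that on `τ * σ univ` the lower one; the other `η / 2` pays for `B`.
  obtain ⟨τ, hτ, hτC, hτσ⟩ : ∃ τ : ℝ≥0, 0 < τ ∧ τ * C ≤ (η / 2 : ℝ≥0) ∧
      τ * σ univ ≤ (η / 2 : ℝ≥0) := by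
    set s := C.toNNReal + (σ univ).toNNReal + 1
    have hs : 0 < s := by positivity
    have h1 : C ≤ s := by
      rw [← ENNReal.coe_toNNReal (show C ≠ ⊤ from ENNReal.ofReal_ne_top)]
      exact_mod_cast le_add_right le_self_add
    have h2 : σ univ ≤ s := by
      rw [← ENNReal.coe_toNNReal (measure_ne_top σ univ)]
      exact_mod_cast le_add_right le_add_self
    have h3 : ((η / 2 / s : ℝ≥0) : ℝ≥0∞) * s = (η / 2 : ℝ≥0) := by
      rw [← ENNReal.coe_mul, div_mul_cancel₀ _ hs.ne']
    refine ⟨η / 2 / s, by positivity, ?_, ?_⟩ <;> rw [← h3] <;> gcongr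
  obtain ⟨ε, hε, hεδ, hflat⟩ := exists_flat_bounds (E := 𝔼) finrank_euclideanSpace_fin hδ
    (K := 1 + τ) (lt_add_of_pos_right 1 hτ)
  refine ⟨ε, hε, fun A hAM hA hAf => ?_⟩
  set H := μHE[m] A
  let I : 𝕊 → ℝ≥0∞ := fun v => ∫⁻ p, intersectionKernel hM (OrientedLine.mk v p) A
  let c : 𝕊 → ℝ≥0∞ := fun v => ENNReal.ofReal |⟪(v : 𝔼), w⟫_ℝ|
  have hcm : Measurable c := by fun_prop
  have hIH : ∀ v, I v ≤ H := fun v => by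
    simpa [inter_eq_right.2 hAM] using lintegral_intersectionKernel_mk_le hM v hA
  have hν : crossingMeasure hM A = ∫⁻ v, I v ∂σ := crossingMeasure_apply hM hA
  have hBint : ∫⁻ v, B.indicator (fun _ => H) v ∂σ ≤ (η / 2 : ℝ≥0) * H := by
    rw [lintegral_indicator_const hBm, mul_comm]
    gcongr
  have hindm : Measurable (B.indicator fun _ : 𝕊 => H) := measurable_const.indicator hBm
  have hηη : ((η / 2 : ℝ≥0) : ℝ≥0∞) + (η / 2 : ℝ≥0) = η := by
    rw [← ENNReal.coe_add, add_halves]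
  refine ⟨?_, ?_, ?_⟩
  · calc crossingMeasure hM A = ∫⁻ v, I v ∂σ := hν
      _ ≤ ∫⁻ v, ((1 + τ : ℝ≥0) * (c v * H) + B.indicator (fun _ => H) v) ∂σ := by
          refine lintegral_mono fun v => ?_
          by_cases hv : v ∈ B
          · rw [indicator_of_mem hv]
            exact (hIH v).trans le_add_self
          · rw [indicator_of_notMem hv, add_zero]
            obtain ⟨h1, h2, -⟩ := hflat v w (norm_eq_of_mem_sphere v) hw (not_lt.1 hv) A hAf
            exact (lintegral_intersectionKernel_mk_le_of_injOn hM v hA h1).trans h2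
      _ ≤ (1 + τ : ℝ≥0) * (C * H) + (η / 2 : ℝ≥0) * H := by
          rw [lintegral_add_right _ hindm, lintegral_const_mul' _ _ ENNReal.coe_ne_top,
            lintegral_mul_const _ hcm, hCint]
          gcongr
      _ = (C + (τ * C + (η / 2 : ℝ≥0))) * H := by push_cast; ring
      _ ≤ (C + ((η / 2 : ℝ≥0) + (η / 2 : ℝ≥0))) * H := by gcongr
      _ = _ := by rw [hηη]
  · calc C * H = ∫⁻ v, c v * H ∂σ := by rw [lintegral_mul_const _ hcm, hCint]
      _ ≤ ∫⁻ v, ((1 + τ : ℝ≥0) * I v + B.indicator (fun _ => H) v) ∂σ := by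
          refine lintegral_mono fun v => ?_
          by_cases hv : v ∈ B
          · rw [indicator_of_mem hv]
            refine le_trans ?_ le_add_self
            refine mul_le_of_le_one_left' (ENNReal.ofReal_le_one.2 ?_)
            have := abs_real_inner_le_norm (v : 𝔼) w
            rwa [hw, norm_eq_of_mem_sphere v, one_mul] at this
          · rw [indicator_of_notMem hv, add_zero]
            obtain ⟨-, -, h3⟩ := hflat v w (norm_eq_of_mem_sphere v) hw (not_lt.1 hv) A hAf
            refine h3.trans ?_
            gcongr
            exact le_lintegral_intersectionKernel_mk hM hfin v hA hAM
      _ ≤ (1 + τ : ℝ≥0) * crossingMeasure hM A + (η / 2 : ℝ≥0) * H := by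
          rw [lintegral_add_right _ hindm, lintegral_const_mul' _ _ ENNReal.coe_ne_top, hν]
          gcongr
      _ = crossingMeasure hM A + (τ * crossingMeasure hM A + (η / 2 : ℝ≥0) * H) := by
          push_cast; ring
      _ ≤ crossingMeasure hM A + (τ * (σ univ * H) + (η / 2 : ℝ≥0) * H) := by
          gcongr
          exact (crossingMeasure_le hM hA).trans_eq (by rw [inter_eq_right.2 hAM])
      _ ≤ crossingMeasure hM A + ((η / 2 : ℝ≥0) * H + (η / 2 : ℝ≥0) * H) := by
          rw [← mul_assoc]
          gcongr
      _ = _ := by rw [← add_mul, hηη]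
  · have hSm : MeasurableSet {l : OrientedLine (m + 1) |
        |⟪l.dir, w⟫_ℝ| ≤ ε ∧ intersectionKernel hM l A ≠ 0} := by
      have hdir : Measurable fun l : OrientedLine (m + 1) => l.dir :=
        measurable_fst.comp measurable_subtype_coe
      have habs : Measurable fun l : OrientedLine (m + 1) => |⟪l.dir, w⟫_ℝ| := by fun_prop
      refine MeasurableSet.inter (measurableSet_le habs measurable_const) ?_
      exact ((intersectionKernel hM).measurable_coe hA (measurableSet_singleton 0)).compl
    rw [kinematicMeasure_apply hSm]
    calc _ ≤ ∫⁻ v, B.indicator (fun _ => H) v ∂σ := by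
          refine lintegral_mono fun v => ?_
          by_cases hv : v ∈ B
          · rw [indicator_of_mem hv]
            refine le_trans ?_ (hIH v)
            have hmeas : Measurable fun p => intersectionKernel hM (OrientedLine.mk v p) A :=
              ((intersectionKernel hM).measurable_coe hA).comp (measurable_mk v)
            have hmarkov := mul_meas_ge_le_lintegral (μ := volume) hmeas 1
            rw [one_mul] at hmarkov
            refine le_trans (measure_mono fun p hp => ?_) hmarkov
            exact one_le_intersectionKernel hM hA hp.2
          -- Since `ε < δ`, every direction this close to tangent lies in `B`.
          · have hempty : OrientedLine.mk v ⁻¹' {l : OrientedLine (m + 1) |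
                |⟪l.dir, w⟫_ℝ| ≤ ε ∧ intersectionKernel hM l A ≠ 0} = ∅ :=
              eq_empty_of_forall_notMem fun p hp => hv (lt_of_le_of_lt hp.1 hεδ)
            simp [hempty]
      _ ≤ _ := hBint
      _ ≤ η * H := by
          gcongr
          exact half_le_self η.2

end Fibers

/-! ### Tangent cones of flat sets -/

section Tangents

variable {E : Type*} [NormedAddCommGroup E] [InnerProductSpace ℝ E]

/-- Tangent vectors are limits of rescaled secants, and the flatness inequality is homogeneous and
closed. -/
theorem IsFlat.abs_inner_le_of_mem_tangentConeAt {w : E} {ε : ℝ} {S : Set E} (hS : IsFlat w ε S)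
    {x y : E} (hx : x ∈ S) (hy : y ∈ tangentConeAt ℝ S x) : |⟪w, y⟫_ℝ| ≤ ε * ‖y‖ := by
  obtain ⟨α, l, hl, c, d, -, hdS, hcd⟩ := exists_fun_of_mem_tangentConeAt hy
  refine le_of_tendsto_of_tendsto ((tendsto_const_nhds.inner hcd).abs)
    (hcd.norm.const_mul ε) ?_
  filter_upwards [hdS] with i hi
  have h := hS _ hi _ hx
  rw [add_sub_cancel_left] at h
  rw [inner_smul_right, abs_mul, norm_smul, Real.norm_eq_abs]
  calc |c i| * |⟪w, d i⟫_ℝ| ≤ |c i| * (ε * ‖d i‖) := by gcongr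
    _ = _ := by ring

/-- A set that has, locally at each of its points, a tangent hyperplane to which it is strictly
tangent and all of which is contained in its tangent cone. -/
structure IsTangentHypersurface [MeasurableSpace E] (G : Set E) : Prop where
  measurableSet : MeasurableSet G
  exists_isFlat : ∀ x ∈ G, ∃ w : E, ‖w‖ = 1 ∧ ∀ ε > 0, ∃ U ∈ 𝓝 x, IsFlat w ε (G ∩ U)
  span_sup_eq_top : ∀ x ∈ G, ∀ v, v ∉ tangentConeAt ℝ G x →
    (ℝ ∙ v) ⊔ Submodule.span ℝ (tangentConeAt ℝ G x) = ⊤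

end Tangents

/-- A set each point of which has a neighbourhood with a hereditary property is the countable
disjoint union of measurable sets with this property. -/
theorem exists_measurable_partition_of_locally {E : Type*} [TopologicalSpace E]
    [SecondCountableTopology E] [MeasurableSpace E] [BorelSpace E] {G : Set E}
    (hG : MeasurableSet G) {Q : Set E → Prop} (hmono : ∀ A B, A ⊆ B → Q B → Q A) (hempty : Q ∅)
    (hQ : ∀ x ∈ G, ∃ U ∈ 𝓝 x, Q (G ∩ U)) :
    ∃ A : ℕ → Set E, (∀ i, MeasurableSet (A i)) ∧ Pairwise (Function.onFun Disjoint A) ∧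
      ⋃ i, A i = G ∧ ∀ i, Q (A i) := by
  rcases G.eq_empty_or_nonempty with rfl | hne
  · exact ⟨fun _ => ∅, by simp, fun i j _ => by simp [Function.onFun], by simp, fun _ => hempty⟩
  have hQ' : ∀ x : E, ∃ U : Set E, x ∈ G → IsOpen U ∧ x ∈ U ∧ Q (G ∩ U) := by
    intro x
    by_cases hx : x ∈ G
    · obtain ⟨U, hU, hUQ⟩ := hQ x hx
      obtain ⟨V, hVU, hV, hxV⟩ := mem_nhds_iff.1 hU
      exact ⟨V, fun _ => ⟨hV, hxV, hmono _ _ (inter_subset_inter_right _ hVU) hUQ⟩⟩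
    · exact ⟨∅, fun h => (hx h).elim⟩
  choose U hU using hQ'
  obtain ⟨t, htG, htc, htU⟩ := TopologicalSpace.countable_cover_nhdsWithin (f := U) (s := G)
    fun x hx => mem_nhdsWithin_of_mem_nhds ((hU x hx).1.mem_nhds (hU x hx).2.1)
  have htne : t.Nonempty := by
    by_contra h
    rw [not_nonempty_iff_eq_empty] at h
    obtain ⟨x, hx⟩ := hne
    simpa [h] using htU hx
  obtain ⟨x, rfl⟩ := htc.exists_eq_range htne
  have hxG : ∀ i, x i ∈ G := fun i => htG (mem_range_self i)
  refine ⟨disjointed fun i => G ∩ U (x i), fun i => MeasurableSet.disjointed (fun j =>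
    hG.inter (hU _ (hxG j)).1.measurableSet) i, disjoint_disjointed _, ?_, fun i =>
    hmono _ _ (disjointed_subset _ i) (hU _ (hxG i)).2.2⟩
  rw [iUnion_disjointed, ← inter_iUnion]
  refine inter_eq_left.2 ?_
  simpa using htU

/-! ### From flat pieces to the whole hypersurface -/

section Global

variable {m : ℕ} {M : Set (EuclideanSpace ℝ (Fin (m + 1)))}

local notation "𝔼" => EuclideanSpace ℝ (Fin (m + 1))

/-- The bounds are required of all measurable subsets of a piece: this makes the property
hereditary, as the partition lemma needs, and lets it be applied to `A ∩ P i`. -/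
theorem exists_partition_crossingMeasure_bounds (hM : IsCompact M) (hfin : μHE[m] M < ⊤) {G : Set 𝔼}
    (hG : IsTangentHypersurface G) (hGM : G ⊆ M) {η : ℝ≥0} (hη : 0 < η) :
    ∃ A : ℕ → Set 𝔼, (∀ i, MeasurableSet (A i)) ∧ Pairwise (Function.onFun Disjoint A) ∧
      ⋃ i, A i = G ∧ ∀ i, ∀ B ⊆ A i, MeasurableSet B →
      crossingMeasure hM B ≤ (ENNReal.ofReal (2 * ballVolume m) + η) * μHE[m] B ∧
      ENNReal.ofReal (2 * ballVolume m) * μHE[m] B ≤ crossingMeasure hM B + η * μHE[m] B ∧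
      kinematicMeasure (m + 1) {l | ∃ x ∈ l.points ∩ B, l.dir ∈ tangentConeAt ℝ G x} ≤
        η * μHE[m] B := by
  refine exists_measurable_partition_of_locally hG.measurableSet
    (Q := fun A => ∀ B ⊆ A, MeasurableSet B →
      crossingMeasure hM B ≤ (ENNReal.ofReal (2 * ballVolume m) + η) * μHE[m] B ∧
      ENNReal.ofReal (2 * ballVolume m) * μHE[m] B ≤ crossingMeasure hM B + η * μHE[m] B ∧
      kinematicMeasure (m + 1) {l | ∃ x ∈ l.points ∩ B, l.dir ∈ tangentConeAt ℝ G x} ≤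
        η * μHE[m] B)
    (fun A A' hAA' h B hB => h B (hB.trans hAA')) ?_ fun x hx => ?_
  · intro B hB _
    rw [subset_empty_iff.1 hB]
    simp
  · obtain ⟨w, hw, hflat⟩ := hG.exists_isFlat x hx
    obtain ⟨ε, hε, hbounds⟩ := exists_crossingMeasure_flat_bounds hM hfin hw hη
    obtain ⟨U, hU, hUf⟩ := hflat ε hε
    obtain ⟨V, hVU, hV, hxV⟩ := mem_nhds_iff.1 hU
    have hVf : IsFlat w ε (G ∩ V) := hUf.mono (inter_subset_inter_right _ hVU)
    refine ⟨V, hV.mem_nhds hxV, fun B hB hBm => ?_⟩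
    obtain ⟨h1, h2, h3⟩ := hbounds B (hB.trans (inter_subset_left.trans hGM)) hBm (hVf.mono hB)
    refine ⟨h1, h2, le_trans (measure_mono_ae ?_) h3⟩
    filter_upwards [ae_count_points_lt_top hM hfin] with l hl hlB
    obtain ⟨y, ⟨hyl, hyB⟩, hyT⟩ := hlB
    refine ⟨?_, (intersectionKernel_ne_zero_iff hM hl hBm).2
      ⟨y, hyB, hyl, hGM (hB hyB).1⟩⟩
    -- The tangent cone is local, so flatness of `G ∩ V` alone controls the tangent vectors of `G`
    -- at `y`.
    rw [← tangentConeAt_inter_nhds (hV.mem_nhds (hB hyB).2)] at hyT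
    have := hVf.abs_inner_le_of_mem_tangentConeAt (hB hyB) hyT
    rwa [show ‖l.dir‖ = 1 from l.2.1, mul_one, real_inner_comm] at this

/-- Summing over the partition leaves an error `η * μHE[m] A`, which tends to `0` with `η` because
the area is finite. -/
theorem crossingMeasure_eq_of_subset (hM : IsCompact M) (hfin : μHE[m] M < ⊤) {G : Set 𝔼}
    (hG : IsTangentHypersurface G) (hGM : G ⊆ M) {A : Set 𝔼} (hA : MeasurableSet A) (hAG : A ⊆ G) :
    crossingMeasure hM A = ENNReal.ofReal (2 * ballVolume m) * μHE[m] A := by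
  set C := ENNReal.ofReal (2 * ballVolume m)
  have hAfin : μHE[m] A ≠ ⊤ := ((measure_mono (hAG.trans hGM)).trans_lt hfin).ne
  have key : ∀ η : ℝ≥0, 0 < η → crossingMeasure hM A ≤ C * μHE[m] A + η * μHE[m] A ∧
      C * μHE[m] A ≤ crossingMeasure hM A + η * μHE[m] A := by
    intro η hη
    obtain ⟨P, hPm, hPd, hPu, hP⟩ := exists_partition_crossingMeasure_bounds hM hfin hG hGM hη
    have hsum : ∀ μ : Measure 𝔼, μ A = ∑' i, μ (A ∩ P i) := by
      intro μ
      rw [← measure_iUnion (fun i j hij => (hPd hij).mono inter_subset_right inter_subset_right)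
        fun i => hA.inter (hPm i), ← inter_iUnion, hPu, inter_eq_left.2 hAG]
    have hb := fun i => hP i (A ∩ P i) inter_subset_right (hA.inter (hPm i))
    rw [hsum μHE[m], hsum (crossingMeasure hM)]
    simp only [← ENNReal.tsum_mul_left, ← ENNReal.tsum_add]
    exact ⟨ENNReal.tsum_le_tsum fun i => (hb i).1.trans_eq (add_mul _ _ _),
      ENNReal.tsum_le_tsum fun i => (hb i).2.1⟩
  have hlim : ∀ a b : ℝ≥0∞, (∀ η : ℝ≥0, 0 < η → a ≤ b + η * μHE[m] A) → a ≤ b := by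
    intro a b h
    have ht : Tendsto (fun η : ℝ≥0 => b + η * μHE[m] A) (𝓝[>] 0) (𝓝 (b + (0 : ℝ≥0) * μHE[m] A)) := by
      refine Tendsto.const_add _ (ENNReal.Tendsto.mul_const ?_ (Or.inr hAfin))
      exact (ENNReal.continuous_coe.tendsto 0).mono_left nhdsWithin_le_nhds
    rw [ENNReal.coe_zero, zero_mul, add_zero] at ht
    refine ge_of_tendsto ht ?_
    filter_upwards [self_mem_nhdsWithin] with η hη using h η hη
  exact le_antisymm (hlim _ _ fun η hη => (key η hη).1) (hlim _ _ fun η hη => (key η hη).2)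

/-- Almost no line is tangent to `G`. -/
theorem ae_forall_dir_notMem_tangentConeAt (hM : IsCompact M) (hfin : μHE[m] M < ⊤) {G : Set 𝔼}
    (hG : IsTangentHypersurface G) (hGM : G ⊆ M) :
    ∀ᵐ l ∂kinematicMeasure (m + 1), ∀ x ∈ l.points ∩ G, l.dir ∉ tangentConeAt ℝ G x := by
  have hGfin : μHE[m] G ≠ ⊤ := ((measure_mono hGM).trans_lt hfin).ne
  have hle : ∀ η : ℝ≥0, 0 < η →
      kinematicMeasure (m + 1) {l | ∃ x ∈ l.points ∩ G, l.dir ∈ tangentConeAt ℝ G x} ≤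
        η * μHE[m] G := by
    intro η hη
    obtain ⟨P, hPm, hPd, hPu, hP⟩ := exists_partition_crossingMeasure_bounds hM hfin hG hGM hη
    calc _ ≤ kinematicMeasure (m + 1)
          (⋃ i, {l | ∃ x ∈ l.points ∩ P i, l.dir ∈ tangentConeAt ℝ G x}) := by
          refine measure_mono fun l hl => ?_
          obtain ⟨x, ⟨hxl, hxG⟩, hx⟩ := hl
          rw [← hPu] at hxG
          obtain ⟨i, hi⟩ := mem_iUnion.1 hxG
          exact mem_iUnion.2 ⟨i, x, ⟨hxl, hi⟩, hx⟩
      _ ≤ ∑' i, kinematicMeasure (m + 1)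
          {l | ∃ x ∈ l.points ∩ P i, l.dir ∈ tangentConeAt ℝ G x} := measure_iUnion_le _
      _ ≤ ∑' i, η * μHE[m] (P i) :=
          ENNReal.tsum_le_tsum fun i => (hP i (P i) subset_rfl (hPm i)).2.2
      _ = η * μHE[m] G := by rw [ENNReal.tsum_mul_left, ← measure_iUnion hPd hPm, hPu]
  rw [ae_iff]
  push Not
  have ht : Tendsto (fun η : ℝ≥0 => η * μHE[m] G) (𝓝[>] 0) (𝓝 ((0 : ℝ≥0) * μHE[m] G)) :=
    ENNReal.Tendsto.mul_const
      ((ENNReal.continuous_coe.tendsto 0).mono_left nhdsWithin_le_nhds) (Or.inr hGfin)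
  rw [ENNReal.coe_zero, zero_mul] at ht
  refine le_antisymm (ge_of_tendsto ht ?_) zero_le
  filter_upwards [self_mem_nhdsWithin] with η hη using hle η hη

variable {ι : Type*} {s : Set ι} {G : ι → Set (EuclideanSpace ℝ (Fin (m + 1)))}

theorem crossingMeasure_eq (hM : IsCompact M) (hfin : μHE[m] M < ⊤) (hs : s.Countable)
    (hG : ∀ i ∈ s, IsTangentHypersurface (G i)) (hGM : ∀ i ∈ s, G i ⊆ M)
    (hnull : μHE[m] (M \ ⋃ i ∈ s, G i) = 0) :
    crossingMeasure hM = ENNReal.ofReal (2 * ballVolume m) • (μHE[m]).restrict M := by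
  set C := ENNReal.ofReal (2 * ballVolume m)
  have hUm : MeasurableSet (⋃ i ∈ s, G i) :=
    MeasurableSet.biUnion hs fun i hi => (hG i hi).measurableSet
  -- The `G i` may overlap; measures that agree on each member of a countable family agree on its
  -- union.
  have h1 : (crossingMeasure hM).restrict (⋃ i ∈ s, G i) =
      (C • (μHE[m]).restrict M).restrict (⋃ i ∈ s, G i) := by
    refine (Measure.restrict_biUnion_congr hs).2 fun i hi => ?_
    ext A hA
    have hAi := hA.inter (hG i hi).measurableSet
    rw [Measure.restrict_apply hA, Measure.restrict_apply hA, Measure.smul_apply,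
      Measure.restrict_apply hAi, smul_eq_mul, inter_eq_left.2 (inter_subset_right.trans (hGM i hi))]
    exact crossingMeasure_eq_of_subset hM hfin (hG i hi) (hGM i hi) hAi inter_subset_right
  have h2 : crossingMeasure hM (⋃ i ∈ s, G i)ᶜ = 0 := by
    refine le_antisymm ((crossingMeasure_le hM hUm.compl).trans ?_) zero_le
    rw [← sdiff_eq, hnull, mul_zero]
  have h3 : (C • (μHE[m]).restrict M) (⋃ i ∈ s, G i)ᶜ = 0 := by
    rw [Measure.smul_apply, Measure.restrict_apply hUm.compl, inter_comm, ← sdiff_eq, hnull,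
      smul_zero]
  rw [Measure.restrict_eq_self_of_ae_mem (s := ⋃ i ∈ s, G i) (mem_ae_iff.2 h2),
    Measure.restrict_eq_self_of_ae_mem (s := ⋃ i ∈ s, G i) (mem_ae_iff.2 h3)] at h1
  exact h1

/-- Almost every line avoids the area-null remainder, so each of its points in `M` lies in some `G
i`, where it is not tangent. Passing from `G i` to `M` only enlarges the tangent cone, so the
spanning property persists. -/
theorem ae_isTransverse (hM : IsCompact M) (hfin : μHE[m] M < ⊤) (hs : s.Countable)
    (hG : ∀ i ∈ s, IsTangentHypersurface (G i)) (hGM : ∀ i ∈ s, G i ⊆ M)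
    (hnull : μHE[m] (M \ ⋃ i ∈ s, G i) = 0) :
    ∀ᵐ l ∂kinematicMeasure (m + 1), l.IsTransverse M := by
  have hUm : MeasurableSet (⋃ i ∈ s, G i) :=
    MeasurableSet.biUnion hs fun i hi => (hG i hi).measurableSet
  have h1 : ∀ᵐ l ∂kinematicMeasure (m + 1), intersectionKernel hM l (M \ ⋃ i ∈ s, G i) = 0 := by
    have h0 : crossingMeasure hM (M \ ⋃ i ∈ s, G i) = 0 := by
      refine le_antisymm ((crossingMeasure_le hM (hM.measurableSet.diff hUm)).trans ?_) zero_le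
      rw [inter_eq_right.2 sdiff_subset, hnull, mul_zero]
    have h0' : ∀ᵐ x ∂crossingMeasure hM, x ∉ M \ ⋃ i ∈ s, G i := measure_eq_zero_iff_ae_notMem.1 h0
    filter_upwards [Measure.ae_ae_of_ae_bind (intersectionKernel hM).aemeasurable h0'] with l hl
    exact measure_eq_zero_iff_ae_notMem.2 hl
  have h2 : ∀ᵐ l ∂kinematicMeasure (m + 1), ∀ i ∈ s, ∀ x ∈ l.points ∩ G i,
      l.dir ∉ tangentConeAt ℝ (G i) x :=
    (ae_ball_iff hs).2 fun i hi => ae_forall_dir_notMem_tangentConeAt hM hfin (hG i hi) (hGM i hi)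
  filter_upwards [h1, h2, ae_count_points_lt_top hM hfin] with l hl1 hl2 hl3 x hx
  have hxG : x ∈ ⋃ i ∈ s, G i := by
    by_contra hxG
    exact (intersectionKernel_ne_zero_iff hM hl3 (hM.measurableSet.diff hUm)).2
      ⟨x, ⟨hx.2, hxG⟩, hx⟩ hl1
  simp only [mem_iUnion] at hxG
  obtain ⟨i, hi, hxi⟩ := hxG
  rw [eq_top_iff, ← (hG i hi).span_sup_eq_top x hxi _ (hl2 i hi x ⟨hx.1, hxi⟩)]
  exact sup_le_sup_left (Submodule.span_mono (tangentConeAt_mono (hGM i hi))) _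

end Global

/-! ### Tangent hyperplanes and area of smooth graphs -/

section Graphs

variable {E : Type*} [NormedAddCommGroup E] [InnerProductSpace ℝ E]

/-- The parametrization `x ↦ x + φ(x) v` of a graph in direction `v`. -/
def graphMap (v : E) (φ : (ℝ ∙ v)ᗮ → ℝ) (x : (ℝ ∙ v)ᗮ) : E := (x : E) + φ x • v

theorem perpProj_graphMap {v : E} (hv : ‖v‖ = 1) (φ : (ℝ ∙ v)ᗮ → ℝ) (x : (ℝ ∙ v)ᗮ) :
    perpProj v (graphMap v φ x) = x := by
  rw [Subtype.ext_iff, coe_perpProj hv, graphMap, inner_add_right, inner_smul_right,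
    inner_eq_zero_of_perp, real_inner_self_eq_norm_sq, hv]
  simp

theorem injective_graphMap {v : E} (hv : ‖v‖ = 1) (φ : (ℝ ∙ v)ᗮ → ℝ) :
    Function.Injective (graphMap v φ) :=
  Function.LeftInverse.injective (perpProj_graphMap hv φ)

theorem continuousOn_graphMap {v : E} {φ : (ℝ ∙ v)ᗮ → ℝ} {D : Set (ℝ ∙ v)ᗮ}
    (hφ : ContDiffOn ℝ ∞ φ D) : ContinuousOn (graphMap v φ) D :=
  continuous_subtype_val.continuousOn.add (hφ.continuousOn.smul continuousOn_const)

theorem contDiffAt_graphMap {v : E} {φ : (ℝ ∙ v)ᗮ → ℝ} {x : (ℝ ∙ v)ᗮ}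
    (hφ : ContDiffAt ℝ ∞ φ x) : ContDiffAt ℝ ∞ (graphMap v φ) x :=
  (ℝ ∙ v)ᗮ.subtypeL.contDiff.contDiffAt.add (hφ.smul contDiffAt_const)

theorem exists_euclideanHausdorffMeasure_graphMap_image_le [MeasurableSpace E] [BorelSpace E]
    {v : E} {φ : (ℝ ∙ v)ᗮ → ℝ}
    {x : (ℝ ∙ v)ᗮ} (hφ : ContDiffAt ℝ ∞ φ x) (m : ℕ) : ∃ K : ℝ≥0, ∃ V ∈ 𝓝 x, ∀ A ⊆ V,
      μHE[m] (graphMap v φ '' A) ≤ (K : ℝ≥0∞) ^ m * μHE[m] A := by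
  obtain ⟨K, V, hV, hLip⟩ := ((contDiffAt_graphMap hφ).of_le
    (by exact_mod_cast le_top)).exists_lipschitzOnWith
  refine ⟨K, V, hV, fun A hA => ?_⟩
  have := euclideanHausdorffMeasure_image_le_of_dist_le m (A := A) (g := id) (h := graphMap v φ)
    fun y hy z hz => hLip.dist_le_mul y (hA hy) z (hA hz)
  simpa using this

variable [FiniteDimensional ℝ E]

/-- The normal `v - ∇φ(x)` of a graph. -/
def graphNormal (v : E) (φ : (ℝ ∙ v)ᗮ → ℝ) (x : (ℝ ∙ v)ᗮ) : E :=
  v - (gradient φ x : (ℝ ∙ v)ᗮ)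

theorem inner_graphNormal {v : E} (hv : ‖v‖ = 1) (φ : (ℝ ∙ v)ᗮ → ℝ) (x : (ℝ ∙ v)ᗮ) (z : E) :
    ⟪graphNormal v φ x, z⟫_ℝ = ⟪v, z⟫_ℝ - fderiv ℝ φ x (perpProj v z) := by
  have h1 : fderiv ℝ φ x (perpProj v z) = ⟪gradient φ x, perpProj v z⟫_ℝ := by
    rw [gradient, InnerProductSpace.toDual_symm_apply]
  rw [graphNormal, inner_sub_left, h1, Submodule.coe_inner, coe_perpProj hv, inner_sub_right,
    inner_smul_right, real_inner_comm v, inner_eq_zero_of_perp]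
  ring

theorem one_le_norm_graphNormal {v : E} (hv : ‖v‖ = 1) (φ : (ℝ ∙ v)ᗮ → ℝ) (x : (ℝ ∙ v)ᗮ) :
    1 ≤ ‖graphNormal v φ x‖ := by
  have h1 : perpProj v v = 0 := by
    rw [Subtype.ext_iff, coe_perpProj hv, real_inner_self_eq_norm_sq, hv]
    simp
  have h2 := inner_graphNormal hv φ x v
  rw [h1, map_zero, real_inner_self_eq_norm_sq, hv] at h2
  have h3 := real_inner_le_norm (graphNormal v φ x) v
  rw [h2, hv] at h3
  linarith

/-- Pairing a secant with the normal `v - ∇φ(x)` gives the error in the linear approximation of `φ`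
at `x`. Strict differentiability makes it small for all pairs of points near `x`, not only for pairs
containing `x`. -/
theorem exists_isFlat_graphOver {v : E} (hv : ‖v‖ = 1) {φ : (ℝ ∙ v)ᗮ → ℝ} {x : (ℝ ∙ v)ᗮ}
    (hφ : ContDiffAt ℝ ∞ φ x) (D : Set (ℝ ∙ v)ᗮ) : ∃ w : E, ‖w‖ = 1 ∧ ∀ ε > 0,
      ∃ U ∈ 𝓝 (graphMap v φ x), IsFlat w ε (graphOver v φ D ∩ U) := by
  set u := graphNormal v φ x
  have hu : 1 ≤ ‖u‖ := one_le_norm_graphNormal hv φ x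
  have hu0 : 0 < ‖u‖ := one_pos.trans_le hu
  refine ⟨‖u‖⁻¹ • u, by rw [norm_smul, norm_inv, norm_norm, inv_mul_cancel₀ hu0.ne'],
    fun ε hε => ?_⟩
  have hd : HasStrictFDerivAt φ (fderiv ℝ φ x) x := hφ.hasStrictFDerivAt (by simp)
  have ho := hd.isLittleO.def hε
  rw [nhds_prod_eq] at ho
  obtain ⟨V, hV, hVε⟩ := mem_prod_same_iff.1 ho
  refine ⟨perpProj v ⁻¹' V, (perpProj v).continuous.continuousAt.preimage_mem_nhds
    (by rwa [perpProj_graphMap hv]), ?_⟩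
  rintro _ ⟨⟨y, -, rfl⟩, hy⟩ _ ⟨⟨z, -, rfl⟩, hz⟩
  change perpProj v (graphMap v φ y) ∈ V at hy
  change perpProj v (graphMap v φ z) ∈ V at hz
  change |⟪_, graphMap v φ y - graphMap v φ z⟫_ℝ| ≤ ε * ‖graphMap v φ y - graphMap v φ z‖
  have hp : perpProj v (graphMap v φ y - graphMap v φ z) = y - z := by
    rw [map_sub, perpProj_graphMap hv, perpProj_graphMap hv]
  rw [perpProj_graphMap hv] at hy hz
  have h1 : ‖φ y - φ z - fderiv ℝ φ x (y - z)‖ ≤ ε * ‖y - z‖ := hVε (mk_mem_prod hy hz)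
  have h2 : ⟪u, graphMap v φ y - graphMap v φ z⟫_ℝ = φ y - φ z - fderiv ℝ φ x (y - z) := by
    rw [inner_graphNormal hv, hp]
    simp [graphMap, inner_sub_right, inner_add_right, inner_smul_right, inner_eq_zero_of_perp, hv]
  have h3 : ‖y - z‖ ≤ ‖graphMap v φ y - graphMap v φ z‖ := hp ▸ norm_perpProj_le v _
  rw [inner_smul_left, h2, abs_mul]
  have h4 : |‖u‖⁻¹| ≤ 1 := by
    rw [abs_of_pos (inv_pos.2 hu0)]
    exact inv_le_one_of_one_le₀ hu
  calc _ ≤ 1 * (ε * ‖y - z‖) := by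
        gcongr
        · exact h4
        · exact h1
    _ ≤ _ := by rw [one_mul]; gcongr

/-- The differential of the parametrization sends `perpProj v z` back to `z` when `z` is orthogonal
to the normal, and every vector is tangent to `D` at `x`. -/
theorem mem_tangentConeAt_graphOver {v : E} (hv : ‖v‖ = 1) {φ : (ℝ ∙ v)ᗮ → ℝ}
    {D : Set (ℝ ∙ v)ᗮ} {x : (ℝ ∙ v)ᗮ} (hD : D ∈ 𝓝 x) (hφ : DifferentiableAt ℝ φ x) {z : E}
    (hz : ⟪graphNormal v φ x, z⟫_ℝ = 0) :
    z ∈ tangentConeAt ℝ (graphOver v φ D) (graphMap v φ x) := by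
  have hF : HasFDerivAt (graphMap v φ)
      ((ℝ ∙ v)ᗮ.subtypeL + (fderiv ℝ φ x).smulRight v) x :=
    (ℝ ∙ v)ᗮ.subtypeL.hasFDerivAt.add (hφ.hasFDerivAt.smul_const v)
  have h := (hF.hasFDerivWithinAt (s := D)).mapsTo_tangent_cone
    (show perpProj v z ∈ tangentConeAt ℝ D x by rw [tangentConeAt_of_mem_nhds hD]; trivial)
  rw [inner_graphNormal hv, sub_eq_zero] at hz
  have hz' : ((ℝ ∙ v)ᗮ.subtypeL + (fderiv ℝ φ x).smulRight v) (perpProj v z) = z := by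
    change (perpProj v z : E) + fderiv ℝ φ x (perpProj v z) • v = z
    rw [← hz, coe_perpProj hv, sub_add_cancel]
  rw [hz'] at h
  exact h

theorem isTangentHypersurface_graphOver [MeasurableSpace E] [BorelSpace E] {v : E} (hv : ‖v‖ = 1)
    {φ : (ℝ ∙ v)ᗮ → ℝ} {D : Set (ℝ ∙ v)ᗮ} (hD : IsOpen D) (hφ : ContDiffOn ℝ ∞ φ D) :
    IsTangentHypersurface (graphOver v φ D) where
  measurableSet := hD.measurableSet.image_of_continuousOn_injOn (continuousOn_graphMap hφ)
    (injective_graphMap hv φ).injOn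
  exists_isFlat := by
    rintro _ ⟨x, hx, rfl⟩
    exact exists_isFlat_graphOver hv (hφ.contDiffAt (hD.mem_nhds hx)) D
  span_sup_eq_top := by
    rintro _ ⟨x, hx, rfl⟩ a ha
    have hcone : ∀ z, ⟪graphNormal v φ x, z⟫_ℝ = 0 →
        z ∈ tangentConeAt ℝ (graphOver v φ D) (graphMap v φ x) := fun z =>
      mem_tangentConeAt_graphOver hv (hD.mem_nhds hx)
        ((hφ.contDiffAt (hD.mem_nhds hx)).differentiableAt (by simp))
    have ha0 : ⟪graphNormal v φ x, a⟫_ℝ ≠ 0 := fun h => ha (hcone a h)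
    -- The tangent cone contains the normal's orthogonal hyperplane, so `a` lies off it; subtracting
    -- the right multiple of `a` moves `z` into it.
    refine eq_top_iff.2 fun z _ => ?_
    set t := ⟪graphNormal v φ x, z⟫_ℝ / ⟪graphNormal v φ x, a⟫_ℝ with ht
    rw [← add_sub_cancel (t • a) z]
    refine Submodule.add_mem_sup (Submodule.smul_mem _ _ (Submodule.mem_span_singleton_self a))
      (Submodule.subset_span (hcone _ ?_))
    rw [inner_sub_right, inner_smul_right, ht, div_mul_cancel₀ _ ha0, sub_self]

variable [MeasurableSpace E] [BorelSpace E]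

theorem euclideanHausdorffMeasure_graphOver_eq_zero {v : E} (hv : ‖v‖ = 1) {φ : (ℝ ∙ v)ᗮ → ℝ}
    {U N : Set (ℝ ∙ v)ᗮ} (hU : IsOpen U) (hφ : ContDiffOn ℝ ∞ φ U) (hNU : N ⊆ U) {m : ℕ}
    (hN : μHE[m] N = 0) : μHE[m] (graphOver v φ N) = 0 := by
  refine measure_null_of_locally_null _ ?_
  rintro _ ⟨x, hx, rfl⟩
  obtain ⟨K, V, hV, hK⟩ := exists_euclideanHausdorffMeasure_graphMap_image_le
    (hφ.contDiffAt (hU.mem_nhds (hNU hx))) m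
  refine ⟨graphMap v φ '' (N ∩ V), ?_, ?_⟩
  · have hmem : perpProj v ⁻¹' V ∈ 𝓝 (graphMap v φ x) :=
      (perpProj v).continuous.continuousAt.preimage_mem_nhds (by rwa [perpProj_graphMap hv])
    refine mem_nhdsWithin.2 ?_
    obtain ⟨W, hWV, hW, hxW⟩ := mem_nhds_iff.1 hmem
    refine ⟨W, hW, hxW, ?_⟩
    rintro _ ⟨hyW, ⟨y, hy, rfl⟩⟩
    refine ⟨y, ⟨hy, ?_⟩, rfl⟩
    have : perpProj v (graphMap v φ y) ∈ V := hWV hyW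
    rwa [perpProj_graphMap hv] at this
  · refine le_antisymm ((hK _ inter_subset_right).trans ?_) zero_le
    rw [measure_mono_null inter_subset_left hN, mul_zero]

/-- A graph is a locally Lipschitz image of a set of smaller dimension. The use is inside `v^⊥`,
where it makes the piecewise smooth boundary of a domain null. -/
theorem euclideanHausdorffMeasure_eq_zero_of_isSmoothGraph {S : Set E} (hS : IsSmoothGraph S) :
    μHE[Module.finrank ℝ E] S = 0 := by
  obtain ⟨v, D, φ, hv, hD, -, hφ, rfl⟩ := hS
  refine euclideanHausdorffMeasure_graphOver_eq_zero hv hD hφ subset_rfl ?_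
  have hlt : Module.finrank ℝ (ℝ ∙ v)ᗮ < Module.finrank ℝ E := by
    have h1 : Module.finrank ℝ (ℝ ∙ v) = 1 :=
      finrank_span_singleton (norm_ne_zero_iff.1 (by simp [hv]))
    have h2 := (ℝ ∙ v).finrank_add_finrank_orthogonal
    omega
  have hnull : (μH[Module.finrank ℝ E] : Measure (ℝ ∙ v)ᗮ) = 0 :=
    Real.hausdorffMeasure_of_finrank_lt (by exact_mod_cast hlt)
  simp [Measure.euclideanHausdorffMeasure_def, hnull]

theorem euclideanHausdorffMeasure_graphOver_lt_top {m : ℕ} (hm : Module.finrank ℝ E = m + 1) {v : E}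
    (hv : ‖v‖ = 1) {φ : (ℝ ∙ v)ᗮ → ℝ} {U N : Set (ℝ ∙ v)ᗮ} (hU : IsOpen U)
    (hφ : ContDiffOn ℝ ∞ φ U) (hNU : N ⊆ U) (hN : IsCompact N) :
    μHE[m] (graphOver v φ N) < ⊤ := by
  refine hN.induction_on (p := fun s => μHE[m] (graphMap v φ '' s) < ⊤) (by simp)
    (fun s t hst ht => (measure_mono (image_mono hst)).trans_lt ht) (fun s t hs ht => ?_)
    fun x hx => ?_
  · rw [image_union]
    exact (measure_union_le _ _).trans_lt (ENNReal.add_lt_top.2 ⟨hs, ht⟩)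
  · obtain ⟨K, V, hV, hK⟩ := exists_euclideanHausdorffMeasure_graphMap_image_le
      (hφ.contDiffAt (hU.mem_nhds (hNU hx))) m
    refine ⟨V ∩ Metric.ball x 1, mem_nhdsWithin_of_mem_nhds
      (inter_mem hV (Metric.ball_mem_nhds x one_pos)), (hK _ inter_subset_left).trans_lt ?_⟩
    refine ENNReal.mul_lt_top (ENNReal.pow_lt_top ENNReal.coe_lt_top)
      ((measure_mono inter_subset_right).trans_lt ?_)
    rw [← finrank_perp hm hv, InnerProductSpace.euclideanHausdorffMeasure_eq_volume]
    exact measure_ball_lt_top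

/-- Up to a set without area, the pieces of a smooth hypersurface have tangent hyperplanes; and
their area is finite. -/
theorem exists_isTangentHypersurface_subset {m : ℕ} (hm : Module.finrank ℝ E = m + 1) {S : Set E}
    (hS : (IsSmoothGraph S ∧ μHE[m] S < ⊤) ∨ IsSmoothGraphWithBoundary S) :
    ∃ G ⊆ S, IsTangentHypersurface G ∧ μHE[m] (S \ G) = 0 ∧ μHE[m] S < ⊤ := by
  rcases hS with ⟨⟨v, D, φ, hv, hD, -, hφ, rfl⟩, hfin⟩ | hS
  · exact ⟨_, subset_rfl, isTangentHypersurface_graphOver hv hD hφ, by simp, hfin⟩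
  · obtain ⟨v, D, U, φ, hv, hD, hDb, ⟨T, hT, hTS, hDT⟩, hU, hDU, hφ, rfl⟩ := hS
    have hDcl : IsCompact (closure D) := hDb.isCompact_closure
    refine ⟨graphOver v φ D, image_mono subset_closure, isTangentHypersurface_graphOver hv hD
      (hφ.mono (subset_closure.trans hDU)), ?_,
      euclideanHausdorffMeasure_graphOver_lt_top hm hv hU hφ hDU hDcl⟩
    have hsub : graphOver v φ (closure D) \ graphOver v φ D ⊆ graphOver v φ (frontier D) := by
      rw [hD.frontier_eq]
      exact (image_sdiff (injective_graphMap hv φ) _ _).superset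
    refine measure_mono_null hsub (euclideanHausdorffMeasure_graphOver_eq_zero hv hU hφ
      (frontier_subset_closure.trans hDU) (measure_mono_null hDT ?_))
    refine (measure_sUnion_null_iff hT.countable).2 fun S hS => ?_
    rw [← finrank_perp hm hv]
    exact euclideanHausdorffMeasure_eq_zero_of_isSmoothGraph (hTS S hS)

end Graphs

/-! ### Integration of `f` against the crossing measure -/

section Formula

variable {m : ℕ} {M : Set (EuclideanSpace ℝ (Fin (m + 1)))}

local notation "𝔼" => EuclideanSpace ℝ (Fin (m + 1))

/-- Both conditions hold for almost every line, so the conventional value `0` in `lineSum` and in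
the kernel never affects the integral. -/
theorem lineSum_eq_integral (hM : IsCompact M) (f : M → ℝ) {l : OrientedLine (m + 1)}
    (hl : l.IsTransverse M) (hfin : Measure.count (l.points ∩ M) < ⊤) :
    lineSum f l = ∫ x, Function.extend Subtype.val f 0 x ∂intersectionKernel hM l := by
  have hs : (l.points ∩ M).Finite := Measure.count_apply_lt_top.1 hfin
  have himg : Subtype.val '' {x : M | (x : 𝔼) ∈ l.points} = hs.toFinset := by
    rw [hs.coe_toFinset]
    ext x
    simp [and_comm]
  have hint : IntegrableOn (Function.extend Subtype.val f 0) (hs.toFinset : Set 𝔼)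
      Measure.count := by
    rw [← (hs.toFinset : Set 𝔼).biUnion_of_singleton, Finset.set_biUnion_coe,
      integrableOn_finset_iUnion]
    exact fun x _ => integrableOn_singleton (hx := by simp)
  rw [intersectionKernel_apply_of_lt_top hM hfin, lineSum, if_pos hl, ← hs.coe_toFinset,
    setIntegral_finset _ hint]
  simp only [measureReal_def, Measure.count_singleton, ENNReal.toReal_one, one_smul]
  rw [← finsum_mem_coe_finset, ← himg, finsum_mem_image Subtype.val_injective.injOn]
  simp only [Subtype.val_injective.extend_apply]

/-- The Cauchy–Crofton formula for a compact set that consists, up to a set without area, of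
countably many pieces with tangent hyperplanes. -/
theorem cauchyCrofton_of_isTangentHypersurface (hM : IsCompact M) (hfin : μHE[m] M < ⊤)
    {ι : Type*} {s : Set ι} {G : ι → Set 𝔼} (hs : s.Countable)
    (hG : ∀ i ∈ s, IsTangentHypersurface (G i)) (hGM : ∀ i ∈ s, G i ⊆ M)
    (hnull : μHE[m] (M \ ⋃ i ∈ s, G i) = 0) {f : M → ℝ} (hf : Continuous f) :
    Integrable f ((μHE[m] : Measure 𝔼).comap Subtype.val) ∧
      Integrable (lineSum f) (kinematicMeasure (m + 1)) ∧
      ∫ x, f x ∂((μHE[m] : Measure 𝔼).comap Subtype.val) =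
        1 / (2 * ballVolume m) * ∫ l, lineSum f l ∂kinematicMeasure (m + 1) := by
  have hMm : MeasurableSet M := hM.measurableSet
  have hemb : MeasurableEmbedding (Subtype.val : M → 𝔼) := .subtype_coe hMm
  set g : 𝔼 → ℝ := Function.extend Subtype.val f 0
  have hgf : ∀ x : M, g x = f x := Subtype.val_injective.extend_apply f 0
  have hgm : Measurable g := hemb.measurable_extend hf.measurable measurable_zero
  have : CompactSpace M := isCompact_iff_compactSpace.1 hM
  have hint : Integrable f ((μHE[m] : Measure 𝔼).comap Subtype.val) := by
    obtain ⟨c, hc⟩ := (isCompact_univ.image hf.norm).bddAbove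
    have : IsFiniteMeasure ((μHE[m] : Measure 𝔼).comap (Subtype.val : M → 𝔼)) :=
      ⟨by rwa [comap_subtype_coe_apply hMm, image_univ, Subtype.range_coe]⟩
    exact Integrable.of_bound hf.aestronglyMeasurable c
      (Eventually.of_forall fun x => hc (mem_image_of_mem _ (mem_univ x)))
  have hgint : IntegrableOn g M μHE[m] := by
    rw [integrableOn_iff_comap_subtypeVal hMm]
    exact hint.congr (Eventually.of_forall fun x => (hgf x).symm)
  have hgeq : ∫ x, f x ∂((μHE[m] : Measure 𝔼).comap Subtype.val) = ∫ x in M, g x ∂μHE[m] := by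
    rw [← integral_subtype_comap hMm]
    exact integral_congr_ae (Eventually.of_forall fun x => (hgf x).symm)
  have hcross := crossingMeasure_eq hM hfin hs hG hGM hnull
  -- Written as a kernel composition, the crossing measure obeys the Fubini-type rule for signed
  -- integrands, which gives both integrability over lines and the iterated integral.
  have hcomp : crossingMeasure hM = (ProbabilityTheory.Kernel.comp (intersectionKernel hM)
      (ProbabilityTheory.Kernel.const Unit (kinematicMeasure (m + 1)))) () :=
    Measure.comp_eq_comp_const_apply
  have hgcross : Integrable g (crossingMeasure hM) := by
    rw [hcross]
    exact hgint.smul_measure ENNReal.ofReal_ne_top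
  have hline : lineSum f =ᵐ[kinematicMeasure (m + 1)] fun l => ∫ x, g x ∂intersectionKernel hM l := by
    filter_upwards [ae_isTransverse hM hfin hs hG hGM hnull, ae_count_points_lt_top hM hfin]
      with l hl1 hl2 using lineSum_eq_integral hM f hl1 hl2
  have hpos : 0 < ballVolume m :=
    ENNReal.toReal_pos (Metric.measure_ball_pos _ _ one_pos).ne' measure_ball_lt_top.ne
  rw [hcomp] at hgcross
  refine ⟨hint, (integrable_congr hline).2 ?_, ?_⟩
  · simpa using hgcross.integral_comp
  · have h := ProbabilityTheory.Kernel.integral_comp hgcross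
    rw [← hcomp, hcross, integral_smul_measure, ENNReal.toReal_ofReal (by positivity),
      ProbabilityTheory.Kernel.const_apply] at h
    rw [hgeq, integral_congr_ae hline, ← h, smul_eq_mul]
    field_simp

end Formula

end CauchyCrofton

end

theorem mainTheorem2 (n : ℕ) (hn : 1 ≤ n) (M : Set (EuclideanSpace ℝ (Fin n)))
    (hM : IsCompact M) (hS : CauchyCrofton.IsSmoothHypersurface M)
    (f : M → ℝ) (hf : Continuous f) :
    Integrable f (CauchyCrofton.areaMeasure M) ∧
      Integrable (CauchyCrofton.lineSum f) (CauchyCrofton.kinematicMeasure n) ∧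
      ∫ x, f x ∂(CauchyCrofton.areaMeasure M) =
        1 / (2 * CauchyCrofton.ballVolume (n - 1)) *
          ∫ l, CauchyCrofton.lineSum f l ∂(CauchyCrofton.kinematicMeasure n) := by
  obtain ⟨m, rfl⟩ : ∃ m, n = m + 1 := ⟨n - 1, by omega⟩
  obtain ⟨T, hT, hTS, rfl⟩ := hS
  simp only [Nat.add_sub_cancel, CauchyCrofton.areaMeasure] at hTS ⊢
  have hpieces := fun S (hS : S ∈ T) => CauchyCrofton.exists_isTangentHypersurface_subset
    finrank_euclideanSpace_fin (hTS S hS)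
  choose! G hGS hG hnull hfin using hpieces
  refine CauchyCrofton.cauchyCrofton_of_isTangentHypersurface hM ?_ hT.countable hG
    (fun S hS => (hGS S hS).trans (subset_sUnion_of_mem hS)) ?_ hf
  · rw [sUnion_eq_biUnion]
    exact measure_biUnion_lt_top hT hfin
  -- A point of `M` outside every `G S` lies in the null remainder of whichever piece contains it.
  · refine measure_mono_null ?_ ((measure_biUnion_null_iff hT.countable).2 hnull)
    rintro x ⟨⟨S, hS, hxS⟩, hxG⟩
    exact mem_biUnion hS ⟨hxS, fun hx => hxG (mem_biUnion hS hx)⟩
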